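/- **Setting.** A multiprogram $P$ is a finite collection of processes, each a finite collection of threads; a thread issues a sequence of operation invocations, the next one depending on the responses to the earlier ones. A (finite) computation $C$ of $P$ gives, for each thread, a finite sequence of its invocations completed with arbitrary responses. $O_C$ is the set of operations of $C$, $O_C|p$ those of process $p$, and $\mathrm{prog}_C$ is the union of the orders of the individual threads. A memory consistency model is a predicate on computations. Variables are local to a process (shared by its threads only). A sequence of operations is valid for variables if each read returns the value of the most recent preceding write to its variable, or the initial value if there is none. *Partial-order broadcast $\mathrm{POB}(L)$.* Besides reads and writes there are $\mathrm{bcast}(u,l)$ and $\mathrm{deliver}(u,l)$, with $u$ an update and $l\in L\cup\{\bot\}$ a label; each update object is unique (no $(u,l)$ is broadcast twice). Put $x\to_{\mathrm{delOrder}} y$ if $x=\mathrm{deliver}(u_1,l_1)$, $y=\mathrm{deliver}(u_2,l_2)$ and $\mathrm{bcast}(u_1,l_1)\to_{\mathrm{prog}}\mathrm{bcast}(u_2,l_2)$. $C$ satisfies $\mathrm{POB}(L)$ if there are total orders $L_p$ of $O_C|p$, one for each process $p$, such that: each $L_p$ is valid for variables, has no deliver before its own bcast and no $\mathrm{deliver}(u,l)$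 twice; $L_p$ extends $\mathrm{prog}$ and $\mathrm{delOrder}$ on $O_C|p$; for all $p,q$ and $l\in L$, $L_p$ and $L_q$ order the deliveries of updates with label $l$ in the same way; and for every $p$, $\mathrm{bcast}(u,l)\in O_C$ if and only if $\mathrm{deliver}(u,l)\in O_C|p$. *Network model $\mathrm{NW}$.* Besides reads and writes there are $\mathrm{send}(s,d,m)$ and $\mathrm{recv}(s,d,m)$ (source, destination, message; messages carry distinct identifiers), and the writes to any one local variable are distinct (they carry sequence numbers). Happens-before is the transitive closure of the union of: program order; $\mathrm{send}(s,d,m)\to\mathrm{recv}(s,d,m)$; $\mathrm{recv}(s,d,m)\to\mathrm{recv}(s,d,m')$ whenever $\mathrm{send}(s,d,m)\to_{\mathrm{prog}}\mathrm{send}(s,d,m')$; and $\mathrm{write}(x,v)\to$ read of $x$ returning $v$, in the same process. $C$ satisfies $\mathrm{NW}$ if there are total orders of the sets $O_C|p$, each valid for variables, containing at most one send and at most one recv of any message, and extending happens-before on $O_C|p$; and $\mathrm{recv}(s,d,m)\in O_C$ if and only if $\mathrm{send}(s,d,m)\in O_C$. *Token-ring transformation $\mathrm{TKN}$.* The processes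 are $0,\dots,n-1$, with $\mathrm{next}(p)=(p+1)\bmod n$. Each process has, for each $l\in L$, Boolean variables $\mathit{needToken}[l]$ (initial value arbitrary) and $\mathit{doorOpen}[l]$ (initially FALSE), and a replica $\hat x$ of each of its variables $x$, with the same initial value. In the threads of process $p$ the invocations are replaced as follows. - A read or write of $x$ becomes a read or write of $\hat x$. - $\mathrm{bcast}(u,\bot)$: send $[\mathrm{MESSAGE},u,\bot]$ to every process $q$ (including $p$). - $\mathrm{bcast}(u,l)$, $l\in L$: $\mathit{needToken}[l]\gets$ TRUE; while $\neg\mathit{doorOpen}[l]$ skip; send $[\mathrm{MESSAGE},u,l]$ to every process $q$, then receive an $[\mathrm{ACK}]$ from every process $q$; $\mathit{doorOpen}[l]\gets$ FALSE; $\mathit{needToken}[l]\gets$ FALSE. - deliver: receive a message $[\mathrm{MESSAGE},u,l]$ from some $q$; if $l\neq\bot$, send $[\mathrm{ACK}]$ to $q$; return $(u,l)$. For each $l\in L$, process $p$ has an additional token thread: if $p=0$, send $[\mathrm{TOKEN},l]$ to $\mathrm{next}(p)$; then loop forever: receive $[\mathrm{TOKEN},l]$; if $\mathit{needToken}[l]$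 then ($\mathit{doorOpen}[l]\gets$ TRUE; while $\mathit{needToken}[l]$ skip); send $[\mathrm{TOKEN},l]$ to $\mathrm{next}(p)$. A computation $\hat C$ of $\mathrm{TKN}(P)$ is finite and consists of completed executions of these subroutines, together with finite partial executions of the token threads. Its interpretation is the computation formed by the invocations of $P$ completed with the responses that their subroutines return. **Theorem.** Let $L$ be any label set and let $P$ be a multiprogram using reads, writes, bcasts and delivers in which each process has two threads, one that calls deliver but not bcast and one that calls bcast but not deliver. Then $\mathrm{TKN}(P)$ correctly implements $\mathrm{POB}(L)$ on $\mathrm{NW}$: every computation $\hat C$ of $\mathrm{TKN}(P)$ satisfying $\mathrm{NW}$ has an interpretation, and its interpretation $C$ is a computation of $P$ which (its update objects being unique) satisfies $\mathrm{POB}(L)$. -/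

import Mathlib

namespace TokenRing

/-! ### Computations -/

/-- An event of a computation: the `idx`-th completed operation of thread `thread` of process
`proc`. -/
structure Event (Proc Thr : Type*) where
  proc : Proc
  thread : Thr
  idx : ℕ

/-- Completed operations: reads and writes of variables that are local to a process (shared by
the threads of that process only), and the further operations `Ext` of the model at hand. -/
inductive Op (Var Val Ext : Type*) where
  | read (x : Var) (v : Val)
  | write (x : Var) (v : Val)
  | ext (a : Ext)

/-- A finite computation: for each thread of each process a finite sequence of completed
operations. -/
abbrev Computation (Proc Thr Op : Type*) := Proc → Thr → List Op

/-- A multiprogram, given by the finite sequences of completed operations that each thread of each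
process can generate when its invocations are completed with arbitrary responses. -/
abbrev Multiprogram (Proc Thr Op : Type*) := Proc → Thr → Set (List Op)

namespace Computation

variable {Proc Thr Op : Type*}

/-- The event `e` is an occurrence of the completed operation `o` in `C`. -/
def Performs (C : Computation Proc Thr Op) (e : Event Proc Thr) (o : Op) : Prop :=
  (C e.proc e.thread)[e.idx]? = some o

/-- `O_C`. -/
def ops (C : Computation Proc Thr Op) : Set (Event Proc Thr) :=
  {e | ∃ o, C.Performs e o}

/-- `O_C | p`. -/
def opsOf (C : Computation Proc Thr Op) (p : Proc) : Set (Event Proc Thr) :=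
  {e | e ∈ C.ops ∧ e.proc = p}

/-- Program order: the union of the orders of the individual threads. -/
def Prog (C : Computation Proc Thr Op) (e f : Event Proc Thr) : Prop :=
  e ∈ C.ops ∧ f ∈ C.ops ∧ e.proc = f.proc ∧ e.thread = f.thread ∧ e.idx < f.idx

end Computation

/-- All computations of a multiprogram. -/
def Multiprogram.computations {Proc Thr Op : Type*} (P : Multiprogram Proc Thr Op) :
    Set (Computation Proc Thr Op) :=
  {C | ∀ p t, C p t ∈ P p t}

/-- The computations of a multiprogram that satisfy a memory consistency model. -/
def Multiprogram.computationsUnder {Proc Thr Op : Type*} (P : Multiprogram Proc Thr Op)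
    (MC : Computation Proc Thr Op → Prop) : Set (Computation Proc Thr Op) :=
  {C | C ∈ P.computations ∧ MC C}

def Extends {α : Type*} (A : Set α) (R T : α → α → Prop) : Prop :=
  ∀ a ∈ A, ∀ b ∈ A, T a b → R a b

/-- `R` is a strict total order on the set `A`. -/
def StrictTotalOn {α : Type*} (A : Set α) (R : α → α → Prop) : Prop :=
  (∀ a ∈ A, ¬ R a a) ∧
  (∀ a ∈ A, ∀ b ∈ A, ∀ c ∈ A, R a b → R b c → R a c) ∧
  (∀ a ∈ A, ∀ b ∈ A, a ≠ b → R a b ∨ R b a)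

/-- Validity of the variable operations of process `p` in the order `lt`: each read returns the
value of the most recent preceding write to the same variable, or the initial value if there is
no preceding write to it. -/
def ValidVars {Proc Thr Var Val Ext : Type*} (C : Computation Proc Thr (Op Var Val Ext))
    (init : Var → Val) (p : Proc) (lt : Event Proc Thr → Event Proc Thr → Prop) : Prop :=
  ∀ r ∈ C.opsOf p, ∀ x v, C.Performs r (.read x v) →
    (∃ w ∈ C.opsOf p, C.Performs w (.write x v) ∧ lt w r ∧
      ∀ w' ∈ C.opsOf p, ∀ v', C.Performs w' (.write x v') → lt w' r → ¬ lt w w') ∨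
    (v = init x ∧ ∀ w ∈ C.opsOf p, ∀ v', C.Performs w (.write x v') → ¬ lt w r)

/-! ### The message-passing network model -/

/-- Message operations; `s` is the source, `d` the destination, and `m` the message, including its
identifier. -/
inductive MsgOp (Proc Msg : Type*) where
  | send (s d : Proc) (m : Msg)
  | recv (s d : Proc) (m : Msg)

section Network

variable {Proc Thr Var Val Msg : Type*}

def MessageOrder (C : Computation Proc Thr (Op Var Val (MsgOp Proc Msg)))
    (e f : Event Proc Thr) : Prop :=
  ∃ s d m, C.Performs e (.ext (.send s d m)) ∧ C.Performs f (.ext (.recv s d m))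

def FifoChannel (C : Computation Proc Thr (Op Var Val (MsgOp Proc Msg)))
    (e f : Event Proc Thr) : Prop :=
  ∃ s d m m', C.Performs e (.ext (.recv s d m)) ∧ C.Performs f (.ext (.recv s d m')) ∧
    ∃ a b, C.Performs a (.ext (.send s d m)) ∧ C.Performs b (.ext (.send s d m')) ∧ C.Prog a b

/-- Variables are local to a process, so equal names in two processes denote two variables. -/
def WritesInto (C : Computation Proc Thr (Op Var Val (MsgOp Proc Msg)))
    (e f : Event Proc Thr) : Prop :=
  e.proc = f.proc ∧ ∃ x v, C.Performs e (.write x v) ∧ C.Performs f (.read x v)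

def HappensBefore (C : Computation Proc Thr (Op Var Val (MsgOp Proc Msg))) :
    Event Proc Thr → Event Proc Thr → Prop :=
  Relation.TransGen fun e f =>
    C.Prog e f ∨ MessageOrder C e f ∨ FifoChannel C e f ∨ WritesInto C e f

/-- At most one send and at most one receive of any message among the operations of `p`. -/
def ValidMessages (C : Computation Proc Thr (Op Var Val (MsgOp Proc Msg))) (p : Proc) : Prop :=
  ∀ e ∈ C.opsOf p, ∀ f ∈ C.opsOf p, ∀ s d m,
    (C.Performs e (.ext (.send s d m)) → C.Performs f (.ext (.send s d m)) → e = f) ∧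
    (C.Performs e (.ext (.recv s d m)) → C.Performs f (.ext (.recv s d m)) → e = f)

/-- The standing assumption of the network model that the writes to any one local variable of a
process are distinct (the values may carry sequence numbers). -/
def DistinctWrites (C : Computation Proc Thr (Op Var Val (MsgOp Proc Msg))) : Prop :=
  ∀ e f, e.proc = f.proc → ∀ x v,
    C.Performs e (.write x v) → C.Performs f (.write x v) → e = f

/-- The message-passing network model; `init p x` is the initial value of variable `x` of
process `p`. -/
def NW (init : Proc → Var → Val) (C : Computation Proc Thr (Op Var Val (MsgOp Proc Msg))) :
    Prop :=
  DistinctWrites C ∧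
  ∃ lt : Proc → Event Proc Thr → Event Proc Thr → Prop,
    (∀ p, StrictTotalOn (C.opsOf p) (lt p) ∧ ValidVars C (init p) p (lt p) ∧ ValidMessages C p) ∧
    (∀ p, Extends (C.opsOf p) (lt p) (HappensBefore C)) ∧
    (∀ s d m, (∃ e, C.Performs e (.ext (.recv s d m))) ↔ (∃ e, C.Performs e (.ext (.send s d m))))

end Network

/-! ### The partial-order broadcast model -/

/-- Broadcast operations. The label `none` is the null label `⊥` of unlabelled updates. -/
inductive BcOp (Upd L : Type*) where
  | bcast (u : Upd) (l : Option L)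
  | deliver (u : Upd) (l : Option L)

section Broadcast

variable {Proc Thr Var Val Upd L : Type*}

/-- Each update object is unique: it is the subject of at most one broadcast. -/
def UniqueUpdates (C : Computation Proc Thr (Op Var Val (BcOp Upd L))) : Prop :=
  ∀ e f u l, C.Performs e (.ext (.bcast u l)) → C.Performs f (.ext (.bcast u l)) → e = f

def DelOrder (C : Computation Proc Thr (Op Var Val (BcOp Upd L))) (e f : Event Proc Thr) : Prop :=
  ∃ u₁ l₁ u₂ l₂, C.Performs e (.ext (.deliver u₁ l₁)) ∧ C.Performs f (.ext (.deliver u₂ l₂)) ∧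
    ∃ a b, C.Performs a (.ext (.bcast u₁ l₁)) ∧ C.Performs b (.ext (.bcast u₂ l₂)) ∧ C.Prog a b

/-- Validity of the broadcast and deliver operations of `p` in the order `lt`: no deliver precedes
its corresponding broadcast, and no specific deliver occurs more than once. -/
def ValidBcasts (C : Computation Proc Thr (Op Var Val (BcOp Upd L))) (p : Proc)
    (lt : Event Proc Thr → Event Proc Thr → Prop) : Prop :=
  (∀ e ∈ C.opsOf p, ∀ f ∈ C.opsOf p, ∀ u l,
    C.Performs e (.ext (.deliver u l)) → C.Performs f (.ext (.bcast u l)) → ¬ lt e f) ∧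
  (∀ e ∈ C.opsOf p, ∀ f ∈ C.opsOf p, ∀ u l,
    C.Performs e (.ext (.deliver u l)) → C.Performs f (.ext (.deliver u l)) → e = f)

/-- In the order `lt` on the operations of `p`, the delivery of `(u₁, l)` precedes that
of `(u₂, l)`. -/
def DeliversBefore (C : Computation Proc Thr (Op Var Val (BcOp Upd L))) (p : Proc)
    (lt : Event Proc Thr → Event Proc Thr → Prop) (l : L) (u₁ u₂ : Upd) : Prop :=
  ∃ e ∈ C.opsOf p, ∃ f ∈ C.opsOf p, C.Performs e (.ext (.deliver u₁ (some l))) ∧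
    C.Performs f (.ext (.deliver u₂ (some l))) ∧ lt e f

/-- The partial-order broadcast model with label set `L`. Agreement identifies the deliveries of
the same labelled update at different processes. -/
def POB (init : Proc → Var → Val) (C : Computation Proc Thr (Op Var Val (BcOp Upd L))) : Prop :=
  ∃ lt : Proc → Event Proc Thr → Event Proc Thr → Prop,
    (∀ p, StrictTotalOn (C.opsOf p) (lt p) ∧ ValidVars C (init p) p (lt p) ∧
      ValidBcasts C p (lt p)) ∧
    (∀ p, Extends (C.opsOf p) (lt p) fun e f => C.Prog e f ∨ DelOrder C e f) ∧
    (∀ p q l u₁ u₂, DeliversBefore C p (lt p) l u₁ u₂ ↔ DeliversBefore C q (lt q) l u₁ u₂) ∧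
    (∀ p u l, (∃ e, C.Performs e (.ext (.bcast u l))) ↔
      (∃ e ∈ C.opsOf p, C.Performs e (.ext (.deliver u l))))

end Broadcast

/-! ### Specification programs -/

/-- Invocations of a program for the partial-order broadcast model. -/
inductive Inv (Var Val Upd L : Type*) where
  | read (x : Var)
  | write (x : Var) (v : Val)
  | bcast (u : Upd) (l : Option L)
  | deliver

/-- Completed operations of a program for the partial-order broadcast model. -/
abbrev SOp (Var Val Upd L : Type*) := Op Var Val (BcOp Upd L)

/-- The invocation of a completed operation. -/
def SOp.inv {Var Val Upd L : Type*} : SOp Var Val Upd L → Inv Var Val Upd L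
  | .read x _ => .read x
  | .write x v => .write x v
  | .ext (.bcast u l) => .bcast u l
  | .ext (.deliver _ _) => .deliver

/-- A thread: given its completed operations so far, the invocations it may issue next
(none if it has halted, exactly one while a deterministic thread is running). -/
abbrev Thread (Var Val Upd L : Type*) := List (SOp Var Val Upd L) → Set (Inv Var Val Upd L)

/-- `h` is a finite run of the thread `t`, the responses being arbitrary. -/
def Thread.IsRun {Var Val Upd L : Type*} (t : Thread Var Val Upd L)
    (h : List (SOp Var Val Upd L)) : Prop :=
  ∀ (k : ℕ) (hk : k < h.length), SOp.inv h[k] ∈ t (h.take k)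

/-- The two threads of each process: `m` is the broadcasting one, `d` the delivering one. -/
inductive SThr where
  | m
  | d

/-- The multiprogram in which thread `t` of process `p` runs `T p t`. -/
def specProgram {n : ℕ} {Var Val Upd L : Type*} (T : Fin n → SThr → Thread Var Val Upd L) :
    Multiprogram (Fin n) SThr (SOp Var Val Upd L) :=
  fun p t => {h | (T p t).IsRun h}

/-! ### Pseudo-code -/

/-- A piece of sequential code, given by its finite complete executions: the sequence of completed
operations performed, together with the returned value. -/
abbrev Code (Op α : Type*) := Set (List Op × α)

namespace Code

variable {Op α β : Type*}

/-- Returns `a` without performing an operation. -/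
def ret (a : α) : Code Op α := {r | r = ([], a)}

def skip : Code Op Unit := ret ()

/-- Performs the single operation `o` and returns `a`. -/
def perform (o : Op) (a : α) : Code Op α := {r | r = ([o], a)}

def bind (c : Code Op α) (k : α → Code Op β) : Code Op β :=
  {r | ∃ t₁ a t₂, (t₁, a) ∈ c ∧ (t₂, r.2) ∈ k a ∧ r.1 = t₁ ++ t₂}

def andThen (c : Code Op Unit) (c' : Code Op β) : Code Op β := bind c fun _ => c'

/-- Executes one of the alternatives. -/
def choice {ι : Type*} (c : ι → Code Op α) : Code Op α := {r | ∃ i, r ∈ c i}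

/-- Executes the body for the members of a list, in order. -/
def forEach : List α → (α → Code Op Unit) → Code Op Unit
  | [], _ => skip
  | a :: as, body => andThen (body a) (forEach as body)

/-- Executes the body once for each process, in any order. -/
def forAll {n : ℕ} (body : Fin n → Code Op Unit) : Code Op Unit :=
  choice fun order : {o : List (Fin n) // o.Perm (List.finRange n)} => forEach order.1 body

/-- Executes the body `k` times. -/
def iterate (body : Code Op Unit) : ℕ → Code Op Unit
  | 0 => skip
  | k + 1 => andThen body (iterate body k)

end Code

infixr:60 " ⨾ " => Code.andThen

/-! ### The token transformation -/

/-- The variables of a process in the transformed program: the replicas of the local variables of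
the specified program, and the two handshake variables for each label. -/
inductive TVar (Var L : Type*) where
  | user (x : Var)
  | needToken (l : L)
  | doorOpen (l : L)

inductive TData (Val : Type*) where
  | val (v : Val)
  | flag (b : Bool)

/-- Values at the target level carry a sequence number. -/
abbrev TVal (Val : Type*) := TData Val × ℕ

/-- Message contents. -/
inductive TContent (Upd L : Type*) where
  | message (u : Upd) (l : Option L)
  | ack
  | token (l : L)

/-- A message consists of its contents and an identifier. -/
abbrev TMsg (Upd L : Type*) := TContent Upd L × ℕ

abbrev TOp (n : ℕ) (Var Val Upd L : Type*) :=
  Op (TVar Var L) (TVal Val) (MsgOp (Fin n) (TMsg Upd L))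

/-- The threads of a process of the transformed program: the transformed threads of the specified
process, and one token thread for each label. -/
inductive TThr (L : Type*) where
  | spec (t : SThr)
  | token (l : L)

/-- The successor of `p` in the ring. -/
def next {n : ℕ} (p : Fin n) : Fin n := ⟨(p.1 + 1) % n, Nat.mod_lt _ p.pos⟩

section Transformation

variable {n : ℕ} {Var Val Upd L : Type*}

/-- Process `p` sends a message with contents `m` (and some identifier) to `q`. -/
def send (p q : Fin n) (m : TContent Upd L) : Code (TOp n Var Val Upd L) Unit :=
  Code.choice fun i : ℕ => Code.perform (.ext (.send p q (m, i))) ()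

/-- Process `p` receives a message that matches a pattern: the pattern maps the values of the
pattern variables to the source and the contents of the message. -/
def recv {α : Type*} (p : Fin n) (pattern : α → Fin n × TContent Upd L) :
    Code (TOp n Var Val Upd L) α :=
  Code.choice fun a : α => Code.choice fun i : ℕ =>
    Code.perform (.ext (.recv (pattern a).1 p ((pattern a).2, i))) a

/-- Reads the replica of a variable of the specified program, and returns its value. -/
def readUser (x : Var) : Code (TOp n Var Val Upd L) Val :=
  Code.choice fun v : Val => Code.choice fun i : ℕ =>
    Code.perform (.read (.user x) (.val v, i)) v

def writeUser (x : Var) (v : Val) : Code (TOp n Var Val Upd L) Unit :=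
  Code.choice fun i : ℕ => Code.perform (.write (.user x) (.val v, i)) ()

/-- Reads a handshake variable, with the result `b`. -/
def readFlagAs (y : TVar Var L) (b : Bool) : Code (TOp n Var Val Upd L) Unit :=
  Code.choice fun i : ℕ => Code.perform (.read y (.flag b, i)) ()

def writeFlag (y : TVar Var L) (b : Bool) : Code (TOp n Var Val Upd L) Unit :=
  Code.choice fun i : ℕ => Code.perform (.write y (.flag b, i)) ()

/-- `if y then c else c'` -/
def ifFlag (y : TVar Var L) (c c' : Code (TOp n Var Val Upd L) Unit) :
    Code (TOp n Var Val Upd L) Unit :=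
  Code.choice fun b : Bool => readFlagAs y b ⨾ (if b then c else c')

/-- `while y = b skip` -/
def spinWhile (y : TVar Var L) (b : Bool) : Code (TOp n Var Val Upd L) Unit :=
  Code.choice fun k : ℕ => Code.iterate (readFlagAs y b) k ⨾ readFlagAs y (!b)

def bcastop (p : Fin n) (u : Upd) (l : Option L) : Code (TOp n Var Val Upd L) Unit :=
  Code.forAll (fun q => send p q (.message u l)) ⨾
  (match l with
    | none => Code.skip
    | some _ => Code.forAll fun q => recv p fun _ : Unit => (q, .ack))

def protectedBcast (p : Fin n) (u : Upd) (l : L) : Code (TOp n Var Val Upd L) Unit :=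
  writeFlag (.needToken l) true ⨾
  spinWhile (.doorOpen l) false ⨾
  bcastop p u (some l) ⨾
  writeFlag (.doorOpen l) false ⨾
  writeFlag (.needToken l) false

/-- The subroutine that replaces an invocation by a thread of process `p`. It returns the completed
specification operation, i.e. the invocation with its response. -/
def tkn (p : Fin n) : Inv Var Val Upd L → Code (TOp n Var Val Upd L) (SOp Var Val Upd L)
  | .read x => Code.bind (readUser x) fun v => Code.ret (.read x v)
  | .write x v => writeUser x v ⨾ Code.ret (.write x v)
  | .bcast u none => bcastop p u none ⨾ Code.ret (.ext (.bcast u none))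
  | .bcast u (some l) => protectedBcast p u l ⨾ Code.ret (.ext (.bcast u (some l)))
  | .deliver =>
      Code.bind (recv p fun r : Fin n × Upd × Option L => (r.1, .message r.2.1 r.2.2))
        fun (q, u, l) =>
          (match l with
            | none => Code.skip
            | some _ => send p q .ack) ⨾
          Code.ret (.ext (.deliver u l))

def passToken (p : Fin n) (l : L) : Code (TOp n Var Val Upd L) Unit :=
  recv p (fun q : Fin n => (q, .token l)) |>.bind fun _ =>
  ifFlag (.needToken l)
    (writeFlag (.doorOpen l) true ⨾ spinWhile (.needToken l) true)
    Code.skip ⨾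
  send p (next p) (.token l)

/-- The token thread of process `p` for label `l`, up to the `k`-th round of its infinite loop. -/
def tokenThread (p : Fin n) (l : L) (k : ℕ) : Code (TOp n Var Val Upd L) Unit :=
  (if p.1 = 0 then send p (next p) (.token l) else Code.skip) ⨾
  Code.iterate (passToken p l) k

/-- `tr` is the concatenation of executions, by process `p`, of the subroutines for the invocations
of the specification operations `h`, each returning the response recorded in `h`. -/
def Implements (p : Fin n) : List (SOp Var Val Upd L) → List (TOp n Var Val Upd L) → Prop
  | [], tr => tr = []
  | o :: h, tr => ∃ t₁ t₂, (t₁, o) ∈ tkn p (SOp.inv o) ∧ Implements p h t₂ ∧ tr = t₁ ++ t₂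

/-- The transformed multiprogram. The specified threads run with each invocation replaced by
its subroutine, whose return value is the response; the token threads, which loop forever, contribute
their finite partial executions. -/
def tknProgram (T : Fin n → SThr → Thread Var Val Upd L) :
    Multiprogram (Fin n) (TThr L) (TOp n Var Val Upd L)
  | p, .spec t => {tr | ∃ h, (T p t).IsRun h ∧ Implements p h tr}
  | p, .token l => {tr | ∃ k full, (full, ()) ∈ tokenThread p l k ∧ tr <+: full}

/-- Initial values in the transformed program. -/
def tknInit (init : Fin n → Var → Val) (need : Fin n → L → Bool) :
    Fin n → TVar Var L → TVal Val
  | p, .user x => (.val (init p x), 0)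
  | p, .needToken l => (.flag (need p l), 0)
  | _, .doorOpen _ => (.flag false, 0)

/-- The specification-level computation `C` is the interpretation of the target-level computation
`C'`: its operations are the invocations completed with the responses that their subroutines return
in `C'`. -/
def Interprets (C' : Computation (Fin n) (TThr L) (TOp n Var Val Upd L))
    (C : Computation (Fin n) SThr (SOp Var Val Upd L)) : Prop :=
  ∀ p t, Implements p (C p t) (C' p (.spec t))

end Transformation

/-- The multiprogram `P'` correctly implements the model `MC` for `P` on the model `MC'`: every
computation of `P'` on `MC'` has an interpretation, and its interpretation is a computation of `P`
on `MC`. Only interpretations that meet the standing assumption `Std` of the model `MC` on the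
computations are considered. -/
def CorrectlyImplements {Proc Thr Thr' Op Op' : Type*}
    (P : Multiprogram Proc Thr Op) (P' : Multiprogram Proc Thr' Op')
    (interprets : Computation Proc Thr' Op' → Computation Proc Thr Op → Prop)
    (Std MC : Computation Proc Thr Op → Prop) (MC' : Computation Proc Thr' Op' → Prop) : Prop :=
  ∀ C' ∈ P'.computationsUnder MC',
    (∃ C, interprets C' C) ∧
    ∀ C, interprets C' C → C ∈ P.computations ∧ (Std C → C ∈ P.computationsUnder MC)

end TokenRing

/-! Order the operations of each process by the positions of the first events of their subroutines
in the network order (`specLt`). The first event of a deliver is the receipt of its message, that of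
a read or write is the access to the replica, and no send of a broadcast precedes its first event.
Most of partial-order broadcast is then inherited: validity of variables from the replicas, "no
deliver before its broadcast" from send-before-receive, delivery order from the FIFO channels,
delivery everywhere from the fact that exactly the sent messages are received. Uniqueness of updates
ties a delivery to its one broadcast.

The substance is agreement on labelled deliveries. Call the stretch of a labelled broadcast from
finding `doorOpen` true to resetting `needToken` its critical section. Every receipt of the update
happens before the section ends (`hb_of_recv`), and the sections of two broadcasts with the same
label are ordered by happens-before (`hb_or_hb_of_bcasts`). Hence any receipt of the first update
precedes the end of the first section, which precedes the start of the second section, the sends of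
the second update and any receipt of it: all processes deliver in the same order.

For receipts, the difficulty is that acknowledgements are anonymous, so a broadcast might consume
one meant for another. Two applications of FIFO show that the passage from a broadcast to the one
consuming its acknowledgement is strictly increasing on a finite set, so the acknowledgement is
consumed no later than in its own broadcast (`AckedIn.le`).

For mutual exclusion, all receipts of the token of a label lie on one chain starting from the
initial send of process 0, so of two rounds at different processes one passes the token on before
the other receives it (`hb_or_hb_of_rounds`). A door found open was opened by some round
(`exists_openedBy`), and that round cannot see `needToken` reset before the broadcast has reset it
(`OpenedBy.hb_tev`); so the round outlasts the section. Sections in one process are ordered by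
program order.

Interpretations are unique because the subroutine traces form a prefix code (`SpecBlock.inj`). -/

namespace TokenRing

/-! ### Shapes of subroutine traces and uniqueness of the interpretation. -/

section Shapes

variable {n : ℕ} {Var Val Upd L : Type*}

/-- The shapes of the traces of the subroutine of process `p` that completes the specification
operation given by the index. -/
inductive SpecBlock (p : Fin n) : SOp Var Val Upd L → List (TOp n Var Val Upd L) → Prop
  | read (x : Var) (v : Val) (i : ℕ) : SpecBlock p (.read x v) [.read (.user x) (.val v, i)]
  | write (x : Var) (v : Val) (i : ℕ) : SpecBlock p (.write x v) [.write (.user x) (.val v, i)]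
  | bcast (u : Upd) (o : List (Fin n)) (ids : Fin n → ℕ) (ho : o.Perm (List.finRange n)) :
      SpecBlock p (.ext (.bcast u none))
        (o.map fun q => .ext (.send p q (.message u none, ids q)))
  | labelledBcast (u : Upd) (l : L) (i j i₂ i₃ : ℕ) (X : List (TOp n Var Val Upd L))
      (hX : ∀ x ∈ X, ∃ k, x = .read (.doorOpen l) (.flag false, k))
      (o o' : List (Fin n)) (ids ids' : Fin n → ℕ)
      (ho : o.Perm (List.finRange n)) (ho' : o'.Perm (List.finRange n)) :
      SpecBlock p (.ext (.bcast u (some l)))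
        (.write (.needToken l) (.flag true, i) :: (X ++ .read (.doorOpen l) (.flag true, j) ::
          ((o.map fun q => .ext (.send p q (.message u (some l), ids q))) ++
          ((o'.map fun q => .ext (.recv q p (.ack, ids' q))) ++
          [.write (.doorOpen l) (.flag false, i₂), .write (.needToken l) (.flag false, i₃)]))))
  | deliver (u : Upd) (q : Fin n) (i : ℕ) :
      SpecBlock p (.ext (.deliver u none)) [.ext (.recv q p (.message u none, i))]
  | labelledDeliver (u : Upd) (l : L) (q : Fin n) (i j : ℕ) :
      SpecBlock p (.ext (.deliver u (some l)))
        [.ext (.recv q p (.message u (some l), i)), .ext (.send p q (.ack, j))]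

/-- The shapes of the rounds of the token thread of process `p` for the label `l`. -/
inductive RoundBlock (p : Fin n) (l : L) : List (TOp n Var Val Upd L) → Prop
  | idle (q : Fin n) (i j k : ℕ) : RoundBlock p l
      [.ext (.recv q p (.token l, i)), .read (.needToken l) (.flag false, j),
        .ext (.send p (next p) (.token l, k))]
  | busy (q : Fin n) (i j k j' k' : ℕ) (X : List (TOp n Var Val Upd L))
      (hX : ∀ x ∈ X, ∃ i, x = .read (.needToken l) (.flag true, i)) : RoundBlock p l
      (.ext (.recv q p (.token l, i)) :: .read (.needToken l) (.flag true, j) ::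
        .write (.doorOpen l) (.flag true, k) :: (X ++
        [.read (.needToken l) (.flag false, j'), .ext (.send p (next p) (.token l, k'))]))

/-- The shapes of what a token thread does before its loop. -/
inductive StartBlock (p : Fin n) (l : L) : List (TOp n Var Val Upd L) → Prop
  | silent (hp : p.1 ≠ 0) : StartBlock p l []
  | initial (hp : p.1 = 0) (i : ℕ) :
      StartBlock p l [.ext (.send p (next p) (.token l, i))]

theorem Code.mem_andThen {Op β : Type*} {c : Code Op Unit} {k : Code Op β} {t : List Op} {b : β} :
    (t, b) ∈ Code.andThen c k ↔ ∃ t₁ t₂, (t₁, ()) ∈ c ∧ (t₂, b) ∈ k ∧ t = t₁ ++ t₂ := by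
  constructor
  · rintro ⟨t₁, _, t₂, h₁, h₂, h⟩
    exact ⟨t₁, t₂, h₁, h₂, h⟩
  · rintro ⟨t₁, t₂, h₁, h₂, h⟩
    exact ⟨t₁, (), t₂, h₁, h₂, h⟩

theorem Code.mem_ret {Op α : Type*} {t : List Op} {a b : α} :
    (t, b) ∈ (Code.ret a : Code Op α) ↔ t = [] ∧ b = a := by
  simp [Code.ret]

theorem Code.mem_perform {Op α : Type*} {o : Op} {t : List Op} {a b : α} :
    (t, b) ∈ Code.perform o a ↔ t = [o] ∧ b = a := by
  simp [Code.perform]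

/-- Without repetitions in the list, the identifier chosen in each pass can be recorded as a
function of the list element. -/
theorem Code.eq_map_of_mem_forEach {Op α : Type*} [DecidableEq α] (f : α → ℕ → Op) :
    ∀ (as : List α) (t : List Op), as.Nodup →
      (t, ()) ∈ Code.forEach as (fun a => Code.choice fun i : ℕ => Code.perform (f a i) ()) →
      ∃ ids : α → ℕ, t = as.map fun a => f a (ids a)
  | [], t, _, h => ⟨fun _ => 0, (Code.mem_ret.1 h).1⟩
  | a :: as, t, hn, h => by
    obtain ⟨t₁, t₂, ⟨i, h₁⟩, h₂, rfl⟩ := Code.mem_andThen.1 h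
    obtain ⟨rfl, -⟩ := Code.mem_perform.1 h₁
    obtain ⟨ids, rfl⟩ := Code.eq_map_of_mem_forEach f as t₂ (List.nodup_cons.1 hn).2 h₂
    refine ⟨Function.update ids a i, ?_⟩
    have ha := (List.nodup_cons.1 hn).1
    simp only [List.map_cons, Function.update_self, List.singleton_append, List.cons.injEq,
      true_and]
    refine List.map_congr_left fun b hb => ?_
    rw [Function.update_of_ne (by rintro rfl; exact ha hb)]

theorem Code.eq_map_of_mem_forAll {Op : Type*} (f : Fin n → ℕ → Op) {t : List Op}
    (h : (t, ()) ∈ Code.forAll (fun q => Code.choice fun i : ℕ => Code.perform (f q i) ())) :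
    ∃ o : List (Fin n), o.Perm (List.finRange n) ∧
      ∃ ids : Fin n → ℕ, t = o.map fun q => f q (ids q) := by
  obtain ⟨⟨o, ho⟩, h⟩ := h
  exact ⟨o, ho, Code.eq_map_of_mem_forEach f o t (ho.nodup_iff.2 (List.nodup_finRange n)) h⟩

theorem mem_writeFlag {y : TVar Var L} {b : Bool} {t : List (TOp n Var Val Upd L)}
    (h : (t, ()) ∈ (writeFlag y b : Code (TOp n Var Val Upd L) Unit)) :
    ∃ i, t = [.write y (.flag b, i)] := by
  obtain ⟨i, h⟩ := h
  exact ⟨i, (Code.mem_perform.1 h).1⟩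

theorem mem_readFlagAs {y : TVar Var L} {b : Bool} {t : List (TOp n Var Val Upd L)}
    (h : (t, ()) ∈ (readFlagAs y b : Code (TOp n Var Val Upd L) Unit)) :
    ∃ i, t = [.read y (.flag b, i)] := by
  obtain ⟨i, h⟩ := h
  exact ⟨i, (Code.mem_perform.1 h).1⟩

theorem mem_send {p q : Fin n} {m : TContent Upd L} {t : List (TOp n Var Val Upd L)}
    (h : (t, ()) ∈ (send p q m : Code (TOp n Var Val Upd L) Unit)) :
    ∃ i, t = [.ext (.send p q (m, i))] := by
  obtain ⟨i, h⟩ := h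
  exact ⟨i, (Code.mem_perform.1 h).1⟩

theorem mem_recv {α : Type*} {p : Fin n} {f : α → Fin n × TContent Upd L} {a : α}
    {t : List (TOp n Var Val Upd L)}
    (h : (t, a) ∈ (recv p f : Code (TOp n Var Val Upd L) α)) :
    ∃ i, t = [.ext (.recv (f a).1 p ((f a).2, i))] := by
  obtain ⟨b, i, h⟩ := h
  obtain ⟨rfl, rfl⟩ := Code.mem_perform.1 h
  exact ⟨i, rfl⟩

theorem mem_iterate_readFlagAs {y : TVar Var L} {b : Bool} :
    ∀ {k : ℕ} {t : List (TOp n Var Val Upd L)},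
      (t, ()) ∈ Code.iterate (readFlagAs y b : Code (TOp n Var Val Upd L) Unit) k →
      ∀ x ∈ t, ∃ i, x = .read y (.flag b, i)
  | 0, t, h, x, hx => by
    obtain ⟨rfl, -⟩ := Code.mem_ret.1 h
    simp at hx
  | k + 1, t, h, x, hx => by
    obtain ⟨t₁, t₂, h₁, h₂, rfl⟩ := Code.mem_andThen.1 h
    obtain ⟨i, rfl⟩ := mem_readFlagAs h₁
    rcases List.mem_append.1 hx with hx | hx
    · exact ⟨i, by simpa using hx⟩
    · exact mem_iterate_readFlagAs h₂ x hx

theorem mem_spinWhile {y : TVar Var L} {b : Bool} {t : List (TOp n Var Val Upd L)}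
    (h : (t, ()) ∈ (spinWhile y b : Code (TOp n Var Val Upd L) Unit)) :
    ∃ X j, (∀ x ∈ X, ∃ i, x = .read y (.flag b, i)) ∧ t = X ++ [.read y (.flag (!b), j)] := by
  obtain ⟨k, h⟩ := h
  obtain ⟨t₁, t₂, h₁, h₂, rfl⟩ := Code.mem_andThen.1 h
  obtain ⟨j, rfl⟩ := mem_readFlagAs h₂
  exact ⟨t₁, j, mem_iterate_readFlagAs h₁, rfl⟩

theorem SpecBlock.of_mem_tkn {p : Fin n} {o : SOp Var Val Upd L}
    {t : List (TOp n Var Val Upd L)} (h : (t, o) ∈ tkn p (SOp.inv o)) : SpecBlock p o t := by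
  rcases o with ⟨x, v⟩ | ⟨x, v⟩ | ⟨u, _ | l⟩ | ⟨u, l⟩
  · obtain ⟨t₁, w, t₂, ⟨v', i, h₁⟩, h₂, rfl⟩ := h
    obtain ⟨rfl, rfl⟩ := Code.mem_perform.1 h₁
    obtain ⟨rfl, h⟩ := Code.mem_ret.1 h₂
    cases h
    exact .read x _ i
  · obtain ⟨t₁, t₂, ⟨i, h₁⟩, h₂, rfl⟩ := Code.mem_andThen.1 h
    obtain ⟨rfl, -⟩ := Code.mem_perform.1 h₁
    obtain ⟨rfl, -⟩ := Code.mem_ret.1 h₂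
    exact .write x v i
  · obtain ⟨_, t₂, h₁, h₂, rfl⟩ := Code.mem_andThen.1 h
    obtain ⟨t₁, t₃, h₃, h₄, rfl⟩ := Code.mem_andThen.1 h₁
    obtain ⟨rfl, -⟩ := Code.mem_ret.1 h₂
    obtain ⟨rfl, -⟩ := Code.mem_ret.1 h₄
    obtain ⟨o, ho, ids, rfl⟩ := Code.eq_map_of_mem_forAll _ h₃
    simpa using SpecBlock.bcast u o ids ho
  · obtain ⟨_, t₂, h₁, h₂, rfl⟩ := Code.mem_andThen.1 h
    obtain ⟨rfl, -⟩ := Code.mem_ret.1 h₂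
    obtain ⟨s₁, _, k₁, h₃, rfl⟩ := Code.mem_andThen.1 h₁
    obtain ⟨s₂, _, k₂, h₄, rfl⟩ := Code.mem_andThen.1 h₃
    obtain ⟨s₃, _, k₃, h₅, rfl⟩ := Code.mem_andThen.1 h₄
    obtain ⟨s₄, s₅, k₄, k₅, rfl⟩ := Code.mem_andThen.1 h₅
    obtain ⟨s₆, s₇, k₆, k₇, rfl⟩ := Code.mem_andThen.1 k₃
    obtain ⟨i, rfl⟩ := mem_writeFlag k₁
    obtain ⟨X, j, hX, rfl⟩ := mem_spinWhile k₂
    obtain ⟨i₂, rfl⟩ := mem_writeFlag k₄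
    obtain ⟨i₃, rfl⟩ := mem_writeFlag k₅
    obtain ⟨o, ho, ids, rfl⟩ := Code.eq_map_of_mem_forAll _ k₆
    -- The dummy pattern variable of type `Unit` is dropped, so that the receives take the form that
    -- `Code.eq_map_of_mem_forAll` expects.
    have k₈ : ∀ q : Fin n, (recv p fun _ : Unit => (q, TContent.ack) :
        Code (TOp n Var Val Upd L) Unit) =
        Code.choice fun i : ℕ => Code.perform (.ext (.recv q p (.ack, i))) () := by
      intro q
      ext ⟨t, _⟩
      exact ⟨fun ⟨_, i, h⟩ => ⟨i, h⟩, fun ⟨i, h⟩ => ⟨(), i, h⟩⟩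
    simp only [k₈] at k₇
    obtain ⟨o', ho', ids', rfl⟩ := Code.eq_map_of_mem_forAll _ k₇
    simpa using SpecBlock.labelledBcast u l i j i₂ i₃ X hX o o' ids ids' ho ho'
  · obtain ⟨t₁, ⟨q, u', l'⟩, t₂, h₁, h₂, rfl⟩ := h
    obtain ⟨i, rfl⟩ := mem_recv h₁
    obtain ⟨t₁, t₂, h₃, h₄, rfl⟩ := Code.mem_andThen.1 h₂
    obtain ⟨rfl, h⟩ := Code.mem_ret.1 h₄
    cases h
    rcases l with _ | l
    · obtain ⟨rfl, -⟩ := Code.mem_ret.1 h₃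
      exact .deliver u q i
    · obtain ⟨j, rfl⟩ := mem_send h₃
      exact .labelledDeliver u l q i j

theorem RoundBlock.of_mem_passToken {p : Fin n} {l : L} {t : List (TOp n Var Val Upd L)}
    (h : (t, ()) ∈ (passToken p l : Code (TOp n Var Val Upd L) Unit)) : RoundBlock p l t := by
  obtain ⟨t₁, q, t₂, h₁, h₂, rfl⟩ := h
  obtain ⟨i, rfl⟩ := mem_recv h₁
  obtain ⟨_, t₂, ⟨b, h₃⟩, h₄, rfl⟩ := Code.mem_andThen.1 h₂
  obtain ⟨k', rfl⟩ := mem_send h₄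
  obtain ⟨t₁, t₂, h₅, h₆, rfl⟩ := Code.mem_andThen.1 h₃
  obtain ⟨j, rfl⟩ := mem_readFlagAs h₅
  cases b
  · obtain ⟨rfl, -⟩ := Code.mem_ret.1 h₆
    exact .idle q i j k'
  · obtain ⟨t₁, t₂, h₇, h₈, rfl⟩ := Code.mem_andThen.1 h₆
    obtain ⟨k, rfl⟩ := mem_writeFlag h₇
    obtain ⟨X, j', hX, rfl⟩ := mem_spinWhile h₈
    simpa using RoundBlock.busy q i j k j' k' X hX

theorem mem_iterate_passToken {p : Fin n} {l : L} :
    ∀ {k : ℕ} {t : List (TOp n Var Val Upd L)},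
      (t, ()) ∈ Code.iterate (passToken p l : Code (TOp n Var Val Upd L) Unit) k →
      ∃ R : List (List (TOp n Var Val Upd L)), (∀ r ∈ R, RoundBlock p l r) ∧ t = R.flatten
  | 0, t, h => ⟨[], by simp, (Code.mem_ret.1 h).1⟩
  | k + 1, t, h => by
    obtain ⟨t₁, t₂, h₁, h₂, rfl⟩ := Code.mem_andThen.1 h
    obtain ⟨R, hR, rfl⟩ := mem_iterate_passToken h₂
    refine ⟨t₁ :: R, ?_, rfl⟩
    simpa using ⟨RoundBlock.of_mem_passToken h₁, hR⟩

theorem mem_tokenThread {p : Fin n} {l : L} {k : ℕ} {t : List (TOp n Var Val Upd L)}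
    (h : (t, ()) ∈ (tokenThread p l k : Code (TOp n Var Val Upd L) Unit)) :
    ∃ s R, StartBlock p l s ∧ (∀ r ∈ R, RoundBlock p l r) ∧ t = (s :: R).flatten := by
  obtain ⟨s, t, h₁, h₂, rfl⟩ := Code.mem_andThen.1 h
  obtain ⟨R, hR, rfl⟩ := mem_iterate_passToken h₂
  refine ⟨s, R, ?_, hR, rfl⟩
  split at h₁
  · obtain ⟨i, rfl⟩ := mem_send h₁
    exact .initial ‹_› i
  · obtain ⟨rfl, -⟩ := Code.mem_ret.1 h₁
    exact .silent ‹_›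

theorem exists_blocks_of_implements {p : Fin n} :
    ∀ {h : List (SOp Var Val Upd L)} {t : List (TOp n Var Val Upd L)}, Implements p h t →
      ∃ B, List.Forall₂ (SpecBlock p) h B ∧ t = B.flatten
  | [], t, h => ⟨[], .nil, h⟩
  | o :: h, t, ⟨t₁, t₂, h₁, h₂, ht⟩ => by
    obtain ⟨B, hB, rfl⟩ := exists_blocks_of_implements h₂
    exact ⟨t₁ :: B, .cons (.of_mem_tkn h₁) hB, ht⟩

/-- Parses a busy-waiting loop, whose length is not known in advance: `a` is recognised as the first
element that violates `P`. -/
theorem append_cons_inj {α : Type*} {P : α → Prop} {a a' : α} {Y Y' : List α} (ha : ¬ P a)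
    (ha' : ¬ P a') : ∀ {X X' : List α}, (∀ x ∈ X, P x) → (∀ x ∈ X', P x) →
      X ++ a :: Y = X' ++ a' :: Y' → X = X' ∧ a = a' ∧ Y = Y'
  | [], [], _, _, h => by simpa using h
  | [], x :: X', _, hX', h => by
    simp only [List.nil_append, List.cons_append, List.cons.injEq] at h
    exact absurd (h.1 ▸ hX' x (by simp)) ha
  | x :: X, [], hX, _, h => by
    simp only [List.nil_append, List.cons_append, List.cons.injEq] at h
    exact absurd (h.1 ▸ hX x (by simp)) ha'
  | x :: X, x' :: X', hX, hX', h => by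
    simp only [List.cons_append, List.cons.injEq] at h
    obtain ⟨rfl, h'⟩ := append_cons_inj ha ha' (fun y hy => hX y (by simp [hy]))
      (fun y hy => hX' y (by simp [hy])) h.2
    exact ⟨by rw [h.1], h'⟩

/-- The existence of `p` forces `n` to be positive. -/
theorem exists_eq_cons_of_perm_finRange (p : Fin n) {o : List (Fin n)}
    (ho : o.Perm (List.finRange n)) : ∃ q o₁, o = q :: o₁ := by
  cases o with
  | nil => exact absurd (ho.mem_iff.2 (List.mem_finRange p)) (by simp)
  | cons q o₁ => exact ⟨q, o₁, rfl⟩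

theorem SpecBlock.ne_nil {p : Fin n} {o : SOp Var Val Upd L} {t : List (TOp n Var Val Upd L)}
    (h : SpecBlock p o t) : t ≠ [] := by
  cases h with
  | bcast u o ids ho =>
    obtain ⟨q, o₁, rfl⟩ := exists_eq_cons_of_perm_finRange p ho
    simp
  | _ => simp

/-- The prefix-code property. The first operation reveals the kind of subroutine; the numbers of
sends and receives are fixed by `n`, and the spinning phase is delimited by the read that finds the
door open. -/
theorem SpecBlock.inj {p : Fin n} {o o' : SOp Var Val Upd L}
    {t t' r r' : List (TOp n Var Val Upd L)} (h : SpecBlock p o t) (h' : SpecBlock p o' t')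
    (e : t ++ r = t' ++ r') : o = o' ∧ t = t' := by
  have hne {o : List (Fin n)} := exists_eq_cons_of_perm_finRange (o := o) p
  cases h with
  | read => cases h' with
    | bcast u o ids ho => obtain ⟨q, o₁, rfl⟩ := hne ho; simp at e
    | _ => simp_all
  | write => cases h' with
    | bcast u o ids ho => obtain ⟨q, o₁, rfl⟩ := hne ho; simp at e
    | _ => simp_all
  | deliver => cases h' with
    | bcast u o ids ho => obtain ⟨q, o₁, rfl⟩ := hne ho; simp at e
    | _ => simp_all
  | labelledDeliver => cases h' with
    | bcast u o ids ho => obtain ⟨q, o₁, rfl⟩ := hne ho; simp at e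
    | _ => simp_all
  | bcast u o ids ho =>
    cases h' with
    | bcast u' o' ids' ho' =>
      have h₁ := (List.append_inj e (by simp [ho.length_eq, ho'.length_eq])).1
      refine ⟨?_, h₁⟩
      obtain ⟨q, o₁, rfl⟩ := hne ho
      obtain ⟨q', o₁', rfl⟩ := hne ho'
      simp_all
    | _ => obtain ⟨q, o₁, rfl⟩ := hne ho; simp at e
  | labelledBcast u l i j i₂ i₃ X hX o o₁ ids ids' ho ho₁ =>
    cases h' with
    | bcast u o ids ho => obtain ⟨q, o₁, rfl⟩ := hne ho; simp at e
    | labelledBcast u' l' i' j' i₂' i₃' X' hX' o' o₁' ids' ids₁' ho' ho₁' =>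
      simp only [List.cons_append, List.append_assoc, List.cons.injEq, Op.write.injEq,
        TVar.needToken.injEq, Prod.mk.injEq, true_and] at e
      obtain ⟨⟨rfl, rfl⟩, e⟩ := e
      obtain ⟨rfl, h₁, e⟩ := append_cons_inj (by simp) (by simp) hX hX' e
      obtain ⟨h₂, e⟩ := List.append_inj e (by simp [ho.length_eq, ho'.length_eq])
      obtain ⟨h₃, e⟩ := List.append_inj e (by simp [ho₁.length_eq, ho₁'.length_eq])
      rw [h₁, h₂, h₃]
      -- One send is enough to recover the update from the trace.
      obtain ⟨q, o₂, rfl⟩ := hne ho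
      obtain ⟨q', o₂', rfl⟩ := hne ho'
      simp_all
    | _ => simp at e

/-- Makes the interpretation unique, so that it agrees with the run that generated the trace. -/
theorem implements_inj {p : Fin n} :
    ∀ {h h' : List (SOp Var Val Upd L)} {t : List (TOp n Var Val Upd L)},
      Implements p h t → Implements p h' t → h = h'
  | [], [], t, _, _ => rfl
  | [], o' :: h', t, e, ⟨t₁, t₂, h₁, h₂, ht⟩ =>
    absurd (List.append_eq_nil_iff.1 (ht.symm.trans e)).1 (SpecBlock.of_mem_tkn h₁).ne_nil
  | o :: h, [], t, ⟨t₁, t₂, h₁, h₂, ht⟩, e =>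
    absurd (List.append_eq_nil_iff.1 (ht.symm.trans e)).1 (SpecBlock.of_mem_tkn h₁).ne_nil
  | o :: h, o' :: h', t, ⟨t₁, t₂, h₁, h₂, e⟩, ⟨t₁', t₂', h₁', h₂', e'⟩ => by
    obtain ⟨rfl, rfl⟩ := (SpecBlock.of_mem_tkn h₁).inj (.of_mem_tkn h₁') (e.symm.trans e')
    obtain rfl : t₂ = t₂' := List.append_cancel_left (e.symm.trans e')
    rw [implements_inj h₂ h₂']

end Shapes

/-! ### Positions in a concatenation of blocks. -/

section Blocks

theorem getElem?_append_cases {α : Type*} {X Y : List α} {j : ℕ} {x : α}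
    (h : (X ++ Y)[j]? = some x) :
    (j < X.length ∧ x ∈ X) ∨ (X.length ≤ j ∧ Y[j - X.length]? = some x) := by
  rcases lt_or_ge j X.length with hj | hj
  · rw [List.getElem?_append_left hj] at h
    exact .inl ⟨hj, List.mem_of_getElem? h⟩
  · rw [List.getElem?_append_right hj] at h
    exact .inr ⟨hj, h⟩

theorem getElem?_cons_cases {α : Type*} {a : α} {Y : List α} {j : ℕ} {x : α}
    (h : (a :: Y)[j]? = some x) :
    (j = 0 ∧ x = a) ∨ (1 ≤ j ∧ Y[j - 1]? = some x) := by
  cases j with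
  | zero => exact .inl ⟨rfl, by simpa using h.symm⟩
  | succ j => exact .inr ⟨by omega, by simpa using h⟩

/-- The position at which the `k`-th block of `B` begins in the concatenation of the blocks. -/
def offset {α : Type*} (B : List (List α)) (k : ℕ) : ℕ := (B.take k).flatten.length

variable {α : Type*} {B : List (List α)}

theorem offset_succ {k : ℕ} {T : List α} (h : B[k]? = some T) :
    offset B (k + 1) = offset B k + T.length := by
  simp [offset, List.take_add_one, h]

theorem offset_mono {k k' : ℕ} (h : k ≤ k') : offset B k ≤ offset B k' := by
  obtain ⟨d, rfl⟩ := Nat.exists_eq_add_of_le h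
  rw [offset, offset, List.take_add, List.flatten_append, List.length_append]
  omega

theorem offset_lt {k k' j j' : ℕ} {T : List α} (h : B[k]? = some T) (hj : j < T.length)
    (hk : k < k') : offset B k + j < offset B k' + j' := by
  have := offset_mono (B := B) (Nat.succ_le_of_lt hk)
  rw [Nat.succ_eq_add_one, offset_succ h] at this
  omega

theorem getElem?_flatten_offset {k j : ℕ} {T : List α} (h : B[k]? = some T) (hj : j < T.length) :
    B.flatten[offset B k + j]? = T[j]? := by
  obtain ⟨hk, rfl⟩ := List.getElem?_eq_some_iff.1 h
  have e : B.flatten = (B.take k).flatten ++ (B[k] ++ (B.drop (k + 1)).flatten) := by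
    rw [← List.flatten_cons, ← List.drop_eq_getElem_cons hk, ← List.flatten_append,
      List.take_append_drop]
  rw [e, List.getElem?_append_right (by simp [offset]), offset, Nat.add_sub_cancel_left,
    List.getElem?_append_left hj]

theorem exists_offset {i : ℕ} {x : α} (h : B.flatten[i]? = some x) :
    ∃ k j T, B[k]? = some T ∧ T[j]? = some x ∧ i = offset B k + j := by
  induction B generalizing i with
  | nil => simp at h
  | cons A B ih =>
    rcases lt_or_ge i A.length with hi | hi
    · rw [List.flatten_cons, List.getElem?_append_left hi] at h
      exact ⟨0, i, A, rfl, h, by simp [offset]⟩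
    · rw [List.flatten_cons, List.getElem?_append_right hi] at h
      obtain ⟨k, j, T, hk, hj, e⟩ := ih h
      refine ⟨k + 1, j, T, by simpa using hk, hj, ?_⟩
      simp only [offset, List.take_succ_cons, List.flatten_cons, List.length_append] at e ⊢
      omega

theorem eq_of_offset_eq {k k' j j' : ℕ} {T T' : List α} (h : B[k]? = some T) (hj : j < T.length)
    (h' : B[k']? = some T') (hj' : j' < T'.length) (e : offset B k + j = offset B k' + j') :
    k = k' ∧ j = j' := by
  rcases lt_trichotomy k k' with hk | rfl | hk
  · have := offset_lt (j' := j') h hj hk; omega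
  · omega
  · have := offset_lt (j' := j) h' hj' hk; omega

theorem lt_of_offset_lt {k k' j j' : ℕ} {T' : List α} 
    (h' : B[k']? = some T') (hj' : j' < T'.length) (e : offset B k + j < offset B k' + j') :
    k < k' ∨ k = k' ∧ j < j' := by
  rcases lt_trichotomy k k' with hk | rfl | hk
  · exact .inl hk
  · exact .inr ⟨rfl, by omega⟩
  · have := offset_lt (j' := j) h' hj' hk; omega

end Blocks

/-! ### Where each kind of operation can occur in a subroutine trace. -/

namespace SpecBlock

variable {n : ℕ} {Var Val Upd L : Type*} {p : Fin n} {a : SOp Var Val Upd L}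
  {T : List (TOp n Var Val Upd L)}

theorem of_send_message (h : SpecBlock p a T) {s d : Fin n} {u : Upd} {l : Option L} {i : ℕ}
    (hx : .ext (.send s d (.message u l, i)) ∈ T) : s = p ∧ a = .ext (.bcast u l) := by
  cases h with
  | labelledBcast _ _ _ _ _ _ X hX =>
    simp only [List.mem_cons, List.mem_append, List.mem_map] at hx
    rcases hx with hx | hx | hx | ⟨_, _, hx⟩ | ⟨_, _, hx⟩ | hx | hx | hx
    · simp at hx
    · simpa using hX _ hx
    all_goals simp_all
  | _ => simp_all

theorem of_recv_message (h : SpecBlock p a T) {s d : Fin n} {u : Upd} {l : Option L} {i : ℕ}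
    {j : ℕ} (hx : T[j]? = some (.ext (.recv s d (.message u l, i)))) :
    d = p ∧ a = .ext (.deliver u l) ∧ j = 0 := by
  cases h with
  | labelledBcast _ _ _ _ _ _ X hX =>
    replace hx := List.mem_of_getElem? hx
    simp only [List.mem_cons, List.mem_append, List.mem_map] at hx
    rcases hx with hx | hx | hx | ⟨_, _, hx⟩ | ⟨_, _, hx⟩ | hx | hx | hx
    · simp at hx
    · simpa using hX _ hx
    all_goals simp_all
  | bcast => simp_all
  | _ => rcases j with _ | _ | j <;> simp_all

theorem of_send_ack (h : SpecBlock p a T) {s d : Fin n} {i : ℕ}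
    {j : ℕ} (hx : T[j]? = some (.ext (.send s d (.ack, i)))) :
    s = p ∧ j = 1 ∧ ∃ u l i', a = .ext (.deliver u (some l)) ∧
      T[0]? = some (.ext (.recv d p (.message u (some l), i'))) := by
  cases h with
  | labelledBcast _ _ _ _ _ _ X hX =>
    replace hx := List.mem_of_getElem? hx
    simp only [List.mem_cons, List.mem_append, List.mem_map] at hx
    rcases hx with hx | hx | hx | ⟨_, _, hx⟩ | ⟨_, _, hx⟩ | hx | hx | hx
    · simp at hx
    · simpa using hX _ hx
    all_goals simp_all
  | bcast => simp_all
  | _ => rcases j with _ | _ | j <;> simp_all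

theorem of_recv_ack (h : SpecBlock p a T) {s d : Fin n} {i : ℕ}
    (hx : .ext (.recv s d (.ack, i)) ∈ T) :
    d = p ∧ ∃ u l, a = .ext (.bcast u (some l)) := by
  cases h with
  | labelledBcast _ _ _ _ _ _ X hX =>
    simp only [List.mem_cons, List.mem_append, List.mem_map] at hx
    rcases hx with hx | hx | hx | ⟨_, _, hx⟩ | ⟨_, _, hx⟩ | hx | hx | hx
    · simp at hx
    · simpa using hX _ hx
    all_goals simp_all
  | _ => simp_all

theorem not_send_token (h : SpecBlock p a T) {s d : Fin n} {l : L} {i : ℕ} :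
    .ext (.send s d (.token l, i)) ∉ T := by
  intro hx
  cases h with
  | labelledBcast _ _ _ _ _ _ X hX =>
    simp only [List.mem_cons, List.mem_append, List.mem_map] at hx
    rcases hx with hx | hx | hx | ⟨_, _, hx⟩ | ⟨_, _, hx⟩ | hx | hx | hx
    · simp at hx
    · simpa using hX _ hx
    all_goals simp_all
  | _ => simp_all

theorem not_recv_token (h : SpecBlock p a T) {s d : Fin n} {l : L} {i : ℕ} :
    .ext (.recv s d (.token l, i)) ∉ T := by
  intro hx
  cases h with
  | labelledBcast _ _ _ _ _ _ X hX =>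
    simp only [List.mem_cons, List.mem_append, List.mem_map] at hx
    rcases hx with hx | hx | hx | ⟨_, _, hx⟩ | ⟨_, _, hx⟩ | hx | hx | hx
    · simp at hx
    · simpa using hX _ hx
    all_goals simp_all
  | _ => simp_all

theorem not_write_doorOpen_true (h : SpecBlock p a T) {l : L} {i : ℕ} :
    .write (.doorOpen l) (.flag true, i) ∉ T := by
  intro hx
  cases h with
  | labelledBcast _ _ _ _ _ _ X hX =>
    simp only [List.mem_cons, List.mem_append, List.mem_map] at hx
    rcases hx with hx | hx | hx | ⟨_, _, hx⟩ | ⟨_, _, hx⟩ | hx | hx | hx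
    · simp at hx
    · simpa using hX _ hx
    all_goals simp_all
  | _ => simp_all

theorem of_write_needToken_false (h : SpecBlock p a T) {l : L} {i : ℕ}
    (hx : .write (.needToken l) (.flag false, i) ∈ T) :
    ∃ u, a = .ext (.bcast u (some l)) := by
  cases h with
  | labelledBcast _ _ _ _ _ _ X hX =>
    simp only [List.mem_cons, List.mem_append, List.mem_map] at hx
    rcases hx with hx | hx | hx | ⟨_, _, hx⟩ | ⟨_, _, hx⟩ | hx | hx | hx
    · simp at hx
    · simpa using hX _ hx
    all_goals simp_all
  | _ => simp_all

theorem of_write_user (h : SpecBlock p a T) {x : Var} {v : TVal Val} {j : ℕ}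
    (hx : T[j]? = some (.write (.user x) v)) :
    j = 0 ∧ ∃ v', v.1 = .val v' ∧ a = .write x v' := by
  cases h with
  | labelledBcast _ _ _ _ _ _ X hX =>
    replace hx := List.mem_of_getElem? hx
    simp only [List.mem_cons, List.mem_append, List.mem_map] at hx
    rcases hx with hx | hx | hx | ⟨_, _, hx⟩ | ⟨_, _, hx⟩ | hx | hx | hx
    · simp at hx
    · simpa using hX _ hx
    all_goals simp_all
  | bcast => simp_all
  | write x' v' i' =>
    rcases j with _ | j
    · simp only [List.getElem?_cons_zero, Option.some.injEq, Op.write.injEq,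
        TVar.user.injEq] at hx
      obtain ⟨rfl, rfl⟩ := hx
      simp
    · simp at hx
  | _ => rcases j with _ | _ | j <;> simp_all

theorem getElem?_zero_read {x : Var} {v : Val} (h : SpecBlock p (.read x v) T) :
    ∃ i, T[0]? = some (.read (.user x) (.val v, i)) := by
  cases h with | read x v i => exact ⟨i, rfl⟩

theorem getElem?_zero_write {x : Var} {v : Val} (h : SpecBlock p (.write x v) T) :
    ∃ i, T[0]? = some (.write (.user x) (.val v, i)) := by
  cases h with | write x v i => exact ⟨i, rfl⟩

theorem getElem?_zero_deliver {u : Upd} {l : Option L} (h : SpecBlock p (.ext (.deliver u l)) T) :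
    ∃ s i, T[0]? = some (.ext (.recv s p (.message u l, i))) := by
  cases h with
  | deliver u q i => exact ⟨q, i, rfl⟩
  | labelledDeliver u l q i => exact ⟨q, i, rfl⟩

theorem exists_send_ack {u : Upd} {l : L} {s : Fin n} {m : TMsg Upd L}
    (h : SpecBlock p (.ext (.deliver u (some l))) T)
    (h₀ : T[0]? = some (.ext (.recv s p m))) :
    ∃ i, T[1]? = some (.ext (.send p s (.ack, i))) := by
  cases h with
  | labelledDeliver u l q i j =>
    simp only [List.getElem?_cons_zero, Option.some.injEq, Op.ext.injEq, MsgOp.recv.injEq] at h₀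
    exact ⟨j, by simp [h₀.1]⟩

theorem exists_send_message {u : Upd} {l : Option L} (h : SpecBlock p (.ext (.bcast u l)) T)
    (d : Fin n) : ∃ i, .ext (.send p d (.message u l, i)) ∈ T := by
  cases h with
  | bcast u o ids ho =>
    exact ⟨ids d, List.mem_map.2 ⟨d, ho.mem_iff.2 (List.mem_finRange d), rfl⟩⟩
  | labelledBcast u l i j i₂ i₃ X hX o o' ids ids' ho ho' =>
    refine ⟨ids d, ?_⟩
    have : (Op.ext (MsgOp.send p d (TContent.message u (some l), ids d)) : TOp n Var Val Upd L) ∈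
        (o.map fun q => .ext (.send p q (.message u (some l), ids q))) :=
      List.mem_map.2 ⟨d, ho.mem_iff.2 (List.mem_finRange d), rfl⟩
    simp only [List.mem_cons, List.mem_append]
    exact .inr (.inr (.inr (.inl this)))

/-- A broadcast sends its update to each destination only once, even under different identifiers;
this is why an update is not delivered twice. -/
theorem pairwise_send_message (h : SpecBlock p a T) :
    T.Pairwise fun x y => ∀ s d u l i u' l' i', x = .ext (.send s d (.message u l, i)) →
      y ≠ .ext (.send s d (.message u' l', i')) := by
  have key : ∀ (o : List (Fin n)) (f : Fin n → TMsg Upd L), o.Perm (List.finRange n) →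
      (o.map fun q => (.ext (.send p q (f q)) : TOp n Var Val Upd L)).Pairwise
      fun x y => ∀ s d u l i u' l' i', x = .ext (.send s d (.message u l, i)) →
      y ≠ .ext (.send s d (.message u' l', i')) := by
    intro o f ho
    rw [List.pairwise_map]
    have : o.Nodup := ho.nodup_iff.2 (List.nodup_finRange n)
    refine List.Pairwise.imp ?_ this
    intro q q' hq s d u l i u' l' i' h₁ h₂
    simp_all
  cases h with
  | bcast u o ids ho => exact key o (fun q => (.message u none, ids q)) ho
  | labelledBcast u l i j i₂ i₃ X hX o o' ids ids' ho ho' =>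
    have hX' : X.Pairwise fun x y => ∀ s d u l i u' l' i', x = .ext (.send s d (.message u l, i)) →
        y ≠ .ext (.send s d (.message u' l', i')) := by
      refine List.pairwise_of_forall_mem_list fun x hx y hy => ?_
      obtain ⟨k, rfl⟩ := hX x hx
      simp
    have hX'' : ∀ x ∈ X, ∀ s d m, x ≠ .ext (.send s d m) := by
      intro x hx
      obtain ⟨k, rfl⟩ := hX x hx
      simp
    refine List.pairwise_cons.2 ⟨by simp, List.pairwise_append.2 ⟨hX', ?_, ?_⟩⟩
    · refine List.pairwise_cons.2 ⟨by simp, List.pairwise_append.2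
        ⟨key o (fun q => (.message u (some l), ids q)) ho, List.pairwise_append.2 ⟨?_, ?_, ?_⟩, ?_⟩⟩
      · rw [List.pairwise_map]
        exact List.pairwise_of_forall (by simp)
      · simp
      · simp
      · intro x _ y hy s d u l i u' l' i' _ e
        subst e
        simp at hy
    · intro x hx y _ s d u l i u' l' i' e
      exact absurd e (hX'' x hx _ _ _)
  | _ => simp

/-- Excludes that one broadcast consumes two acknowledgements from the same process, which gives the
strictness in `AckedIn.lt`. -/
theorem pairwise_recv_ack (h : SpecBlock p a T) :
    T.Pairwise fun x y => ∀ s d i i', x = .ext (.recv s d (.ack, i)) →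
      y ≠ .ext (.recv s d (.ack, i')) := by
  cases h with
  | bcast u o ids ho =>
    rw [List.pairwise_map]
    exact List.pairwise_of_forall (by simp)
  | labelledBcast u l i j i₂ i₃ X hX o o' ids ids' ho ho' =>
    have hX'' : ∀ x ∈ X, ∀ s d m, x ≠ .ext (.recv s d m) := by
      intro x hx
      obtain ⟨k, rfl⟩ := hX x hx
      simp
    refine List.pairwise_cons.2 ⟨by simp, List.pairwise_append.2 ⟨?_, ?_, ?_⟩⟩
    · refine List.pairwise_of_forall_mem_list fun x hx y hy => ?_
      obtain ⟨k, rfl⟩ := hX x hx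
      simp
    · refine List.pairwise_cons.2 ⟨by simp, List.pairwise_append.2
        ⟨?_, List.pairwise_append.2 ⟨?_, ?_, ?_⟩, ?_⟩⟩
      · rw [List.pairwise_map]
        exact List.pairwise_of_forall (by simp)
      · rw [List.pairwise_map]
        have : o'.Nodup := ho'.nodup_iff.2 (List.nodup_finRange n)
        refine List.Pairwise.imp ?_ this
        intro q q' hq s d i i' h₁ h₂
        simp_all
      · simp
      · intro x _ y hy s d i i' _ e
        subst e
        simp at hy
      · intro x hx y _ s d i i' e
        subst e
        simp at hx
    · intro x hx y _ s d i i' e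
      exact absurd e (hX'' x hx _ _ _)
  | _ => simp

/-- The positions `r`, `w`, `w + 1` in the trace of a labelled broadcast at which it finds its door
open, shuts the door, and resets `needToken`. -/
structure Critical (l : L) (T : List (TOp n Var Val Upd L)) (r w : ℕ) : Prop where
  read_door : ∃ i, T[r]? = some (.read (.doorOpen l) (.flag true, i))
  write_door : ∃ i, T[w]? = some (.write (.doorOpen l) (.flag false, i))
  write_need : ∃ i, T[w + 1]? = some (.write (.needToken l) (.flag false, i))
  lt : r < w
  of_send : ∀ j s d m, T[j]? = some (.ext (.send s d m)) → r < j
  of_recv : ∀ j s d m, T[j]? = some (.ext (.recv s d m)) → j < w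
  of_write_need : ∀ j i, T[j]? = some (.write (.needToken l) (.flag false, i)) → j = w + 1

theorem exists_critical {u : Upd} {l : L} (h : SpecBlock p (.ext (.bcast u (some l))) T) :
    ∃ r w, Critical l T r w := by
  cases h with
  | labelledBcast u l i j i₂ i₃ X hX o o' ids ids' ho ho' =>
    have hX₁ : ∀ x ∈ X, ∀ s d m, x ≠ .ext (.send s d m) := by
      intro x hx
      obtain ⟨k, rfl⟩ := hX x hx
      simp
    have hX₂ : ∀ x ∈ X, ∀ y v, x ≠ .write y v := by
      intro x hx
      obtain ⟨k, rfl⟩ := hX x hx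
      simp
    have hlen := ho.length_eq
    have hlen' := ho'.length_eq
    rw [List.length_finRange] at hlen hlen'
    -- The setting of `needToken` and the unsuccessful reads `X` precede position `r`; the
    -- successful read, `n` sends and `n` acknowledgements then lead up to `w`.
    refine ⟨1 + X.length, 1 + X.length + 1 + n + n, ⟨j, ?_⟩, ⟨i₂, ?_⟩, ⟨i₃, ?_⟩, by omega, ?_, ?_,
      ?_⟩
    · rw [List.getElem?_cons, if_neg (by omega), List.getElem?_append_right (by omega)]
      simp
    · rw [List.getElem?_cons, if_neg (by omega), List.getElem?_append_right (by omega),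
        List.getElem?_cons, if_neg (by omega), List.getElem?_append_right (by simp; omega),
        List.getElem?_append_right (by simp; omega)]
      have : 1 + X.length + 1 + n + n - 1 - X.length - 1 - n - n = 0 := by omega
      simp [hlen, hlen', this]
    · rw [List.getElem?_cons, if_neg (by omega), List.getElem?_append_right (by omega),
        List.getElem?_cons, if_neg (by omega), List.getElem?_append_right (by simp; omega),
        List.getElem?_append_right (by simp; omega)]
      have : 1 + X.length + 1 + n + n - X.length - 1 - n - n = 1 := by omega
      simp [hlen, hlen', this]
    · intro k s d m hk
      rcases getElem?_cons_cases hk with ⟨_, h⟩ | ⟨h₁, hk⟩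
      · simp at h
      rcases getElem?_append_cases hk with ⟨_, h⟩ | ⟨h₂, hk⟩
      · exact absurd rfl (hX₁ _ h _ _ _)
      rcases getElem?_cons_cases hk with ⟨_, h⟩ | ⟨h₃, hk⟩
      · simp at h
      omega
    · intro k s d m hk
      by_contra hlt
      rw [List.getElem?_cons, if_neg (by omega), List.getElem?_append_right (by omega),
        List.getElem?_cons, if_neg (by omega), List.getElem?_append_right (by simp; omega),
        List.getElem?_append_right (by simp; omega)] at hk
      simpa using List.mem_of_getElem? hk
    · intro k i' hk
      rcases getElem?_cons_cases hk with ⟨_, h⟩ | ⟨h₁, hk⟩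
      · simp at h
      rcases getElem?_append_cases hk with ⟨_, h⟩ | ⟨h₂, hk⟩
      · exact absurd rfl (hX₂ _ h _ _)
      rcases getElem?_cons_cases hk with ⟨_, h⟩ | ⟨h₃, hk⟩
      · simp at h
      rcases getElem?_append_cases hk with ⟨_, h⟩ | ⟨h₄, hk⟩
      · simp at h
      rcases getElem?_append_cases hk with ⟨_, h⟩ | ⟨h₅, hk⟩
      · simp at h
      rcases getElem?_cons_cases hk with ⟨_, h⟩ | ⟨h₆, hk⟩
      · simp at h
      rcases getElem?_cons_cases hk with ⟨h₇, h⟩ | ⟨h₇, hk⟩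
      · simp only [List.length_map, hlen, hlen'] at h₄ h₅ h₆ h₇
        omega
      · simp at hk

end SpecBlock

/-! ### Where each kind of operation can occur in a round of a token thread. -/

namespace RoundBlock

variable {n : ℕ} {Var Val Upd L : Type*} {p : Fin n} {l : L}
  {T : List (TOp n Var Val Upd L)}

theorem getElem?_zero (h : RoundBlock p l T) :
    ∃ q i, T[0]? = some (.ext (.recv q p (.token l, i))) := by
  cases h with
  | idle q i => exact ⟨q, i, rfl⟩
  | busy q i => exact ⟨q, i, rfl⟩

theorem of_recv (h : RoundBlock p l T) {j : ℕ} {s d : Fin n} {m : TMsg Upd L}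
    (hx : T[j]? = some (.ext (.recv s d m))) : j = 0 ∧ d = p ∧ m.1 = .token l := by
  cases h with
  | idle q i =>
    rcases j with _ | _ | _ | j <;> simp [Prod.ext_iff] at hx
    simp [← hx.2.2.1, hx.2.1]
  | busy q i j k j' k' X hX =>
    rcases getElem?_cons_cases hx with ⟨rfl, h⟩ | ⟨_, hx⟩
    · simp_all
    have hx := List.mem_of_getElem? hx
    simp only [List.mem_cons, List.mem_append] at hx
    rcases hx with h | h | h | h | h | h
    · simp at h
    · simp at h
    · simpa using hX _ h
    all_goals simp at h

theorem of_send (h : RoundBlock p l T) {j : ℕ} {s d : Fin n} {m : TMsg Upd L}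
    (hx : T[j]? = some (.ext (.send s d m))) :
    j + 1 = T.length ∧ 1 < j ∧ s = p ∧ d = next p ∧ m.1 = .token l ∧
      ∃ i, T[j - 1]? = some (.read (.needToken l) (.flag false, i)) := by
  cases h with
  | idle q i =>
    rcases j with _ | _ | _ | j <;> simp [Prod.ext_iff] at hx
    simp [← hx.2.2.1, hx.1, ← hx.2.1]
  | busy q i j k j' k' X hX =>
    rcases getElem?_cons_cases hx with ⟨rfl, h⟩ | ⟨_, hx⟩
    · simp_all
    rcases getElem?_cons_cases hx with ⟨_, h⟩ | ⟨_, hx⟩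
    · simp_all
    rcases getElem?_cons_cases hx with ⟨_, h⟩ | ⟨_, hx⟩
    · simp_all
    rcases getElem?_append_cases hx with ⟨_, h⟩ | ⟨h, hx⟩
    · simpa using hX _ h
    rcases getElem?_cons_cases hx with ⟨_, h⟩ | ⟨_, hx⟩
    · simp_all
    rcases getElem?_cons_cases hx with ⟨h₁, h⟩ | ⟨_, hx⟩
    · refine ⟨by simp; omega, by omega, by simp_all, by simp_all, by simp_all, j', ?_⟩
      rw [List.getElem?_cons, if_neg (by omega), List.getElem?_cons, if_neg (by omega),
        List.getElem?_cons, if_neg (by omega), List.getElem?_append_right (by omega),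
        List.getElem?_cons, if_pos (by omega)]
    · simp at hx

/-- A round opens the door right after it has found `needToken` set; it cannot end before it has
found `needToken` reset. -/
theorem of_write_door (h : RoundBlock p l T) {j : ℕ} {x : TVar Var L} {v : TVal Val}
    (hx : T[j]? = some (.write x v)) :
    j = 2 ∧ x = .doorOpen l ∧ v.1 = .flag true ∧
    (∃ i, T[1]? = some (.read (.needToken l) (.flag true, i))) ∧
    ∃ f, 2 < f ∧ f + 2 = T.length ∧
      ∃ i, T[f]? = some (.read (.needToken l) (.flag false, i)) := by
  cases h with
  | idle q i => rcases j with _ | _ | _ | j <;> simp_all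
  | busy q i j k j' k' X hX =>
    rcases getElem?_cons_cases hx with ⟨rfl, h⟩ | ⟨_, hx⟩
    · simp_all
    rcases getElem?_cons_cases hx with ⟨_, h⟩ | ⟨_, hx⟩
    · simp_all
    rcases getElem?_cons_cases hx with ⟨_, h⟩ | ⟨_, hx⟩
    -- The loop is left after the three opening operations and the reads in `X`.
    · refine ⟨by omega, by simp_all, by simp_all, ⟨_, rfl⟩, X.length + 3, by omega, by simp, j', ?_⟩
      simp
    rcases getElem?_append_cases hx with ⟨_, h⟩ | ⟨h, hx⟩
    · simpa using hX _ h
    have hx := List.mem_of_getElem? hx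
    simp at hx

end RoundBlock

theorem StartBlock.eq_send {n : ℕ} {Var Val Upd L : Type*} {p : Fin n} {l : L}
    {T : List (TOp n Var Val Upd L)} (h : StartBlock p l T) {j : ℕ} {o : TOp n Var Val Upd L}
    (hx : T[j]? = some o) : j = 0 ∧ p.1 = 0 ∧ ∃ i, o = .ext (.send p (next p) (.token l, i)) := by
  cases h with
  | silent => simp at hx
  | initial hp i =>
    rcases j with _ | j <;> simp at hx
    exact ⟨rfl, hp, i, hx.symm⟩

theorem Computation.Performs.inj {Proc Thr Op : Type*} {C : Computation Proc Thr Op}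
    {e : Event Proc Thr} {o o' : Op} (h : C.Performs e o) (h' : C.Performs e o') : o = o' :=
  Option.some.inj (h.symm.trans h')

/-- A computation of the transformed program that satisfies the network model, together with an
interpretation, a decomposition of its threads into the executions of the subroutines and into the
rounds of the token threads, and the total orders of the network model. -/
structure Execution {n : ℕ} {Var Val Upd L : Type*} (init : Fin n → Var → Val)
    (need : Fin n → L → Bool) (C' : Computation (Fin n) (TThr L) (TOp n Var Val Upd L))
    (C : Computation (Fin n) SThr (SOp Var Val Upd L)) where
  blocks : Fin n → SThr → List (List (TOp n Var Val Upd L))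
  specBlock : ∀ p t, List.Forall₂ (SpecBlock p) (C p t) (blocks p t)
  flatten_blocks : ∀ p t, C' p (.spec t) = (blocks p t).flatten
  start : Fin n → L → List (TOp n Var Val Upd L)
  startBlock : ∀ p l, StartBlock p l (start p l)
  rounds : Fin n → L → List (List (TOp n Var Val Upd L))
  roundBlock : ∀ p l, ∀ T ∈ rounds p l, RoundBlock p l T
  prefix_rounds : ∀ p l, C' p (.token l) <+: (start p l :: rounds p l).flatten
  thread_bcast : ∀ b u l, C.Performs b (.ext (.bcast u l)) → b.thread = .m
  thread_deliver : ∀ b u l, C.Performs b (.ext (.deliver u l)) → b.thread = .d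
  lt : Fin n → Event (Fin n) (TThr L) → Event (Fin n) (TThr L) → Prop
  strictTotal : ∀ p, StrictTotalOn (C'.opsOf p) (lt p)
  validVars : ∀ p, ValidVars C' (tknInit init need p) p (lt p)
  validMessages : ∀ p, ValidMessages C' p
  extends_hb : ∀ p, Extends (C'.opsOf p) (lt p) (HappensBefore C')
  recv_iff_send : ∀ s d m, (∃ e, C'.Performs e (.ext (.recv s d m))) ↔
    (∃ e, C'.Performs e (.ext (.send s d m)))

namespace Execution

variable {n : ℕ} {Var Val Upd L : Type*} {init : Fin n → Var → Val}
  {need : Fin n → L → Bool} {C' : Computation (Fin n) (TThr L) (TOp n Var Val Upd L)}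
  {C : Computation (Fin n) SThr (SOp Var Val Upd L)} (E : Execution init need C' C)

/-! ### Happens-before -/

theorem mem_ops_of_hb {e f : Event (Fin n) (TThr L)} (h : HappensBefore C' e f) :
    e ∈ C'.ops ∧ f ∈ C'.ops := by
  have step : ∀ e f, (C'.Prog e f ∨ MessageOrder C' e f ∨ FifoChannel C' e f ∨
      WritesInto C' e f) → e ∈ C'.ops ∧ f ∈ C'.ops := by
    rintro e f (h | ⟨s, d, m, h, h'⟩ | ⟨s, d, m, m', h, h', -⟩ | ⟨-, x, v, h, h'⟩)
    · exact ⟨h.1, h.2.1⟩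
    all_goals exact ⟨⟨_, h⟩, ⟨_, h'⟩⟩
  induction h with
  | single h => exact step _ _ h
  | tail _ h ih => exact ⟨ih.1, (step _ _ h).2⟩

theorem hb_of_idx_lt {e f : Event (Fin n) (TThr L)} {o o' : TOp n Var Val Upd L}
    (he : C'.Performs e o) (hf : C'.Performs f o') (hp : e.proc = f.proc)
    (ht : e.thread = f.thread) (h : e.idx < f.idx) : HappensBefore C' e f :=
  .single (.inl ⟨⟨_, he⟩, ⟨_, hf⟩, hp, ht, h⟩)

theorem hb_of_message {e f : Event (Fin n) (TThr L)} {s d : Fin n} {m : TMsg Upd L}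
    (he : C'.Performs e (.ext (.send s d m))) (hf : C'.Performs f (.ext (.recv s d m))) :
    HappensBefore C' e f :=
  .single (.inr (.inl ⟨s, d, m, he, hf⟩))

theorem hb_of_fifo {e f a b : Event (Fin n) (TThr L)} {s d : Fin n} {m m' : TMsg Upd L}
    (he : C'.Performs e (.ext (.recv s d m))) (hf : C'.Performs f (.ext (.recv s d m')))
    (ha : C'.Performs a (.ext (.send s d m))) (hb : C'.Performs b (.ext (.send s d m')))
    (hp : a.proc = b.proc) (ht : a.thread = b.thread) (h : a.idx < b.idx) :
    HappensBefore C' e f :=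
  .single (.inr (.inr (.inl ⟨s, d, m, m', he, hf, a, b, ha, hb, ⟨_, ha⟩, ⟨_, hb⟩, hp, ht, h⟩)))

theorem hb_of_writesInto {e f : Event (Fin n) (TThr L)} {x : TVar Var L} {v : TVal Val}
    (hp : e.proc = f.proc) (he : C'.Performs e (.write x v)) (hf : C'.Performs f (.read x v)) :
    HappensBefore C' e f :=
  .single (.inr (.inr (.inr ⟨hp, x, v, he, hf⟩)))

theorem lt_of_hb {e f : Event (Fin n) (TThr L)} {p : Fin n} (h : HappensBefore C' e f)
    (he : e.proc = p) (hf : f.proc = p) : E.lt p e f :=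
  have := mem_ops_of_hb h
  E.extends_hb p e ⟨this.1, he⟩ f ⟨this.2, hf⟩ h

theorem not_hb_self (E : Execution init need C' C)
    (e : Event (Fin n) (TThr L)) : ¬ HappensBefore C' e e := fun h =>
  (E.strictTotal e.proc).1 e ⟨(mem_ops_of_hb h).1, rfl⟩ (E.lt_of_hb h rfl rfl)

theorem lt_trans {p : Fin n} {e f g : Event (Fin n) (TThr L)} (he : e ∈ C'.opsOf p)
    (hf : f ∈ C'.opsOf p) (hg : g ∈ C'.opsOf p) (h : E.lt p e f) (h' : E.lt p f g) :
    E.lt p e g :=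
  (E.strictTotal p).2.1 e he f hf g hg h h'

theorem lt_asymm {p : Fin n} {e f : Event (Fin n) (TThr L)} (he : e ∈ C'.opsOf p)
    (hf : f ∈ C'.opsOf p) (h : E.lt p e f) : ¬ E.lt p f e := fun h' =>
  (E.strictTotal p).1 e he (E.lt_trans he hf he h h')

theorem lt_of_not_lt {p : Fin n} {e f : Event (Fin n) (TThr L)} (he : e ∈ C'.opsOf p)
    (hf : f ∈ C'.opsOf p) (hne : e ≠ f) (h : ¬ E.lt p e f) : E.lt p f e :=
  ((E.strictTotal p).2.2 e he f hf hne).resolve_left h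

theorem idx_lt_of_lt {p : Fin n} {e f : Event (Fin n) (TThr L)} (he : e ∈ C'.opsOf p)
    (hf : f ∈ C'.opsOf p) (ht : e.thread = f.thread) (h : E.lt p e f) : e.idx < f.idx := by
  have hp : e.proc = f.proc := he.2.trans hf.2.symm
  rcases lt_trichotomy e.idx f.idx with h' | h' | h'
  · exact h'
  · have : e = f := by
      cases e; cases f; simp_all
    subst this
    exact absurd h ((E.strictTotal p).1 e he)
  · obtain ⟨o, ho⟩ := he.1
    obtain ⟨o', ho'⟩ := hf.1
    exact absurd (E.lt_of_hb (hb_of_idx_lt ho' ho hp.symm ht.symm h') hf.2 he.2)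
      (E.lt_asymm he hf h)

theorem idx_lt_of_hb (E : Execution init need C' C)
    {e f : Event (Fin n) (TThr L)} (h : HappensBefore C' e f)
    (hp : e.proc = f.proc) (ht : e.thread = f.thread) : e.idx < f.idx :=
  have := mem_ops_of_hb h
  E.idx_lt_of_lt ⟨this.1, hp⟩ ⟨this.2, rfl⟩ ht (E.lt_of_hb h hp rfl)

/-! ### The events of the specified threads -/

/-- The `j`-th event of the subroutine that implements the specification event `b`. -/
def ev (b : Event (Fin n) SThr) (j : ℕ) : Event (Fin n) (TThr L) :=
  ⟨b.proc, .spec b.thread, offset (E.blocks b.proc b.thread) b.idx + j⟩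

/-- The specification event `b` performs `a`, and is implemented by the trace `T`. -/
def At (b : Event (Fin n) SThr) (a : SOp Var Val Upd L) (T : List (TOp n Var Val Upd L)) : Prop :=
  C.Performs b a ∧ (E.blocks b.proc b.thread)[b.idx]? = some T ∧ SpecBlock b.proc a T

variable {E}
variable {b b' : Event (Fin n) SThr} {a a' : SOp Var Val Upd L}
  {T T' : List (TOp n Var Val Upd L)} {o o' : TOp n Var Val Upd L} {j j' : ℕ}

theorem exists_at (h : C.Performs b a) : ∃ T, E.At b a T := by
  have h₂ := List.forall₂_iff_get.1 (E.specBlock b.proc b.thread)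
  obtain ⟨hlt, h₁⟩ := List.getElem?_eq_some_iff.1 h
  have hlt' := h₂.1 ▸ hlt
  refine ⟨_, h, List.getElem?_eq_getElem hlt', ?_⟩
  have := h₂.2 b.idx hlt hlt'
  rwa [List.get_eq_getElem, List.get_eq_getElem, h₁] at this

theorem At.inj (h : E.At b a T) (h' : E.At b a' T') : a = a' ∧ T = T' :=
  ⟨h.1.inj h'.1, Option.some.inj (h.2.1.symm.trans h'.2.1)⟩

theorem At.performs (h : E.At b a T) (hj : T[j]? = some o) : C'.Performs (E.ev b j) o := by
  have := getElem?_flatten_offset h.2.1 (List.getElem?_eq_some_iff.1 hj).1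
  rw [hj, ← E.flatten_blocks] at this
  exact this

theorem exists_ev {e : Event (Fin n) (TThr L)} {t : SThr} (h : C'.Performs e o)
    (ht : e.thread = .spec t) :
    ∃ b a T j, E.At b a T ∧ T[j]? = some o ∧ e = E.ev b j ∧ b.thread = t := by
  obtain ⟨p, _, i⟩ := e
  obtain rfl : _ = TThr.spec t := ht
  rw [Computation.Performs, E.flatten_blocks] at h
  dsimp only at h
  obtain ⟨k, j, T, hT, hj, rfl⟩ := exists_offset h
  have h₂ := List.forall₂_iff_get.1 (E.specBlock p t)
  obtain ⟨hlt, -⟩ := List.getElem?_eq_some_iff.1 hT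
  have hlt' := h₂.1.symm ▸ hlt
  obtain ⟨T', h'⟩ := exists_at (E := E) (b := ⟨p, t, k⟩) (List.getElem?_eq_getElem hlt')
  obtain rfl := Option.some.inj (h'.2.1.symm.trans hT)
  exact ⟨⟨p, t, k⟩, _, T', j, h', hj, rfl, rfl⟩

theorem At.hb_of_lt (h : E.At b a T) (hj : T[j]? = some o) (hj' : T[j']? = some o')
    (hlt : j < j') : HappensBefore C' (E.ev b j) (E.ev b j') :=
  hb_of_idx_lt (h.performs hj) (h.performs hj') rfl rfl (Nat.add_lt_add_left hlt _)

theorem At.idx_ev_lt (h : E.At b a T) (hj : T[j]? = some o) (hp : b.proc = b'.proc)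
    (ht : b.thread = b'.thread) (hlt : b.idx < b'.idx) : (E.ev b j).idx < (E.ev b' j').idx := by
  have := offset_lt (j' := j') h.2.1 (List.getElem?_eq_some_iff.1 hj).1 hlt
  simpa only [ev, hp, ht] using this

theorem At.hb_of_idx_lt (h : E.At b a T) (hj : T[j]? = some o) (h' : E.At b' a' T')
    (hj' : T'[j']? = some o') (hp : b.proc = b'.proc) (ht : b.thread = b'.thread)
    (hlt : b.idx < b'.idx) : HappensBefore C' (E.ev b j) (E.ev b' j') := by
  refine Execution.hb_of_idx_lt (h.performs hj) (h'.performs hj') hp ?_ (h.idx_ev_lt hj hp ht hlt)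
  rw [ev, ev, ht]

theorem At.lt_of_ev_lt (h' : E.At b' a' T') (hj' : T'[j']? = some o')
    (hp : b.proc = b'.proc) (ht : b.thread = b'.thread)
    (hlt : (E.ev b j).idx < (E.ev b' j').idx) : b.idx < b'.idx ∨ b.idx = b'.idx ∧ j < j' := by
  refine lt_of_offset_lt h'.2.1 (List.getElem?_eq_some_iff.1 hj').1 ?_
  simpa only [ev, hp, ht] using hlt

theorem At.ev_inj (h : E.At b a T) (hj : T[j]? = some o) (h' : E.At b' a' T')
    (hj' : T'[j']? = some o') (e : E.ev b j = E.ev b' j') : b = b' ∧ j = j' := by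
  obtain ⟨p, t, k⟩ := b
  obtain ⟨p', t', k'⟩ := b'
  simp only [ev, Event.mk.injEq, TThr.spec.injEq] at e
  obtain ⟨rfl, rfl, e⟩ := e
  obtain ⟨rfl, rfl⟩ := eq_of_offset_eq h.2.1 (List.getElem?_eq_some_iff.1 hj).1 h'.2.1
    (List.getElem?_eq_some_iff.1 hj').1 e
  exact ⟨rfl, rfl⟩

theorem At.getElem?_zero (h : E.At b a T) : ∃ o, T[0]? = some o := by
  have := h.2.2.ne_nil
  cases T with
  | nil => exact absurd rfl this
  | cons o T => exact ⟨o, rfl⟩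

variable (E)

/-! ### The events of the token threads -/

/-- The `j`-th event of the `k`-th round of the token thread of `p` for `l`. -/
def tev (p : Fin n) (l : L) (k j : ℕ) : Event (Fin n) (TThr L) :=
  ⟨p, .token l, offset (E.start p l :: E.rounds p l) (k + 1) + j⟩

variable {E}
variable {p q : Fin n} {l : L} {k k' : ℕ}

/-- A token thread may be cut off in mid-round: its events are events of the complete rounds, but
not conversely. -/
theorem getElem?_prefix_performs {e : Event (Fin n) (TThr L)} (h : C'.Performs e o)
    (ht : e.thread = .token l) :
    (E.start e.proc l :: E.rounds e.proc l).flatten[e.idx]? = some o := by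
  have h' : (C' e.proc (.token l))[e.idx]? = some o := by rw [← ht]; exact h
  obtain ⟨hlt, h₂⟩ := List.getElem?_eq_some_iff.1 h'
  rw [List.prefix_iff_getElem?.1 (E.prefix_rounds e.proc l) e.idx hlt, h₂]

theorem exists_tev {e : Event (Fin n) (TThr L)} (h : C'.Performs e o)
    (ht : e.thread = .token l) :
    (e.idx = 0 ∧ e.proc.1 = 0 ∧ ∃ i, o = .ext (.send e.proc (next e.proc) (.token l, i))) ∨
    ∃ k T j, (E.rounds e.proc l)[k]? = some T ∧ T[j]? = some o ∧ e = E.tev e.proc l k j := by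
  obtain ⟨k, j, T, hT, hj, he⟩ := exists_offset (getElem?_prefix_performs (E := E) h ht)
  -- Block 0 is what precedes the loop, so that rounds are shifted by one against blocks.
  cases k with
  | zero =>
    obtain rfl : E.start e.proc l = T := by simpa using hT
    obtain ⟨rfl, hp, ho⟩ := (E.startBlock e.proc l).eq_send hj
    exact .inl ⟨by rw [he]; simp [offset], hp, ho⟩
  | succ k =>
    refine .inr ⟨k, T, j, by simpa using hT, hj, ?_⟩
    cases e
    simp_all [tev]

theorem getElem?_cons_rounds (hT : (E.rounds p l)[k]? = some T) :
    (E.start p l :: E.rounds p l)[k + 1]? = some T := by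
  simpa using hT

theorem roundBlock_of_getElem? (hT : (E.rounds p l)[k]? = some T) : RoundBlock p l T :=
  E.roundBlock p l T (List.mem_of_getElem? hT)

/-- The events of a token thread are closed under predecessors. -/
theorem performs_tev {e : Event (Fin n) (TThr L)} (h : C'.Performs e o) (hp : e.proc = p)
    (ht : e.thread = .token l) (hT : (E.rounds p l)[k]? = some T) (hj : T[j]? = some o')
    (hle : (E.tev p l k j).idx ≤ e.idx) : C'.Performs (E.tev p l k j) o' := by
  have h₁ := getElem?_flatten_offset (getElem?_cons_rounds hT) (List.getElem?_eq_some_iff.1 hj).1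
  have h' : (C' p (.token l))[e.idx]? = some o := by rw [← ht, ← hp]; exact h
  have hlt := (List.getElem?_eq_some_iff.1 h').1
  have hlt' : (E.tev p l k j).idx < (C' p (.token l)).length := hle.trans_lt hlt
  have h₂ := List.prefix_iff_getElem?.1 (E.prefix_rounds p l) _ hlt'
  rw [hj] at h₁
  have h₃ := Option.some.inj (h₁.symm.trans h₂)
  rw [h₃]
  exact List.getElem?_eq_getElem hlt'

theorem performs_tev_of_le (h : C'.Performs (E.tev p l k j') o) (hle : j ≤ j')
    (hT : (E.rounds p l)[k]? = some T) (hj : T[j]? = some o') :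
    C'.Performs (E.tev p l k j) o' :=
  performs_tev h rfl rfl hT hj (Nat.add_le_add_left hle _)

theorem idx_tev_lt (hT : (E.rounds p l)[k]? = some T) (hj : T[j]? = some o) (hlt : k < k') :
    (E.tev p l k j).idx < (E.tev p l k' j').idx :=
  offset_lt (getElem?_cons_rounds hT) (List.getElem?_eq_some_iff.1 hj).1 (Nat.succ_lt_succ hlt)

theorem hb_tev_of_lt (h : C'.Performs (E.tev p l k j) o) (h' : C'.Performs (E.tev p l k j') o')
    (hlt : j < j') : HappensBefore C' (E.tev p l k j) (E.tev p l k j') :=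
  hb_of_idx_lt h h' rfl rfl (Nat.add_lt_add_left hlt _)

/-! ### Sends and receives -/

section Messages

variable {e f : Event (Fin n) (TThr L)} {s d : Fin n} {i : ℕ} {u : Upd} {lo : Option L}

theorem exists_ev_of_send_message (E : Execution init need C' C)
    (h : C'.Performs e (.ext (.send s d (.message u lo, i)))) :
    ∃ b T j, E.At b (.ext (.bcast u lo)) T ∧ T[j]? = some (.ext (.send s d (.message u lo, i))) ∧
      e = E.ev b j ∧ b.proc = s ∧ b.thread = .m := by
  cases ht : e.thread with
  | spec t =>
    obtain ⟨b, a, T, j, hb, hj, he, -⟩ := exists_ev (E := E) h ht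
    obtain ⟨rfl, rfl⟩ := hb.2.2.of_send_message (List.mem_of_getElem? hj)
    exact ⟨b, T, j, hb, hj, he, rfl, E.thread_bcast _ _ _ hb.1⟩
  | token l =>
    rcases exists_tev (E := E) h ht with ⟨-, -, i, h⟩ | ⟨k, T, j, hT, hj, -⟩
    · simp at h
    · simpa using ((roundBlock_of_getElem? hT).of_send hj).2.2.2.2.1

/-- That the deliveries of a process lie in one thread puts its acknowledgements in program order,
as FIFO on the return channel requires. -/
theorem exists_ev_of_recv_message (E : Execution init need C' C)
    (h : C'.Performs e (.ext (.recv s d (.message u lo, i)))) :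
    ∃ b T, E.At b (.ext (.deliver u lo)) T ∧
      T[0]? = some (.ext (.recv s d (.message u lo, i))) ∧
      e = E.ev b 0 ∧ b.proc = d ∧ b.thread = .d := by
  cases ht : e.thread with
  | spec t =>
    obtain ⟨b, a, T, j, hb, hj, he, -⟩ := exists_ev (E := E) h ht
    obtain ⟨rfl, rfl, rfl⟩ := hb.2.2.of_recv_message hj
    exact ⟨b, T, hb, hj, he, rfl, E.thread_deliver _ _ _ hb.1⟩
  | token l =>
    rcases exists_tev (E := E) h ht with ⟨-, -, i, h⟩ | ⟨k, T, j, hT, hj, -⟩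
    · simp at h
    · simpa using ((roundBlock_of_getElem? hT).of_recv hj).2.2

theorem exists_ev_of_recv_ack (E : Execution init need C' C)
    (h : C'.Performs e (.ext (.recv s d (.ack, i)))) :
    ∃ b u l T j, E.At b (.ext (.bcast u (some l))) T ∧
      T[j]? = some (.ext (.recv s d (.ack, i))) ∧ e = E.ev b j ∧ b.proc = d ∧ b.thread = .m := by
  cases ht : e.thread with
  | spec t =>
    obtain ⟨b, a, T, j, hb, hj, he, -⟩ := exists_ev (E := E) h ht
    obtain ⟨rfl, u, l, rfl⟩ := hb.2.2.of_recv_ack (List.mem_of_getElem? hj)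
    exact ⟨b, u, l, T, j, hb, hj, he, rfl, E.thread_bcast _ _ _ hb.1⟩
  | token l =>
    rcases exists_tev (E := E) h ht with ⟨-, -, i, h⟩ | ⟨k, T, j, hT, hj, -⟩
    · simp at h
    · simpa using ((roundBlock_of_getElem? hT).of_recv hj).2.2

theorem exists_tev_of_send_token (E : Execution init need C' C)
    (h : C'.Performs e (.ext (.send s d (.token l, i)))) :
    e.proc = s ∧ e.thread = .token l ∧ (e.idx = 0 ∧ s.1 = 0 ∨
      ∃ k T j, (E.rounds s l)[k]? = some T ∧ j + 1 = T.length ∧ 1 < j ∧ e = E.tev s l k j) := by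
  cases ht : e.thread with
  | spec t =>
    obtain ⟨b, a, T, j, hb, hj, he, -⟩ := exists_ev (E := E) h ht
    exact absurd (List.mem_of_getElem? hj) hb.2.2.not_send_token
  | token l' =>
    rcases exists_tev (E := E) h ht with ⟨h₀, hp, i, h⟩ | ⟨k, T, j, hT, hj, he⟩
    · simp only [Op.ext.injEq, MsgOp.send.injEq, Prod.mk.injEq, TContent.token.injEq] at h
      obtain ⟨rfl, -, rfl, -⟩ := h
      exact ⟨rfl, rfl, .inl ⟨h₀, hp⟩⟩
    · obtain ⟨h₁, h₂, h₃, -, h₄, -⟩ := (roundBlock_of_getElem? hT).of_send hj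
      obtain rfl : l = l' := by simpa using h₄
      subst h₃
      exact ⟨rfl, rfl, .inr ⟨k, T, j, hT, h₁, h₂, he⟩⟩

theorem exists_tev_of_recv_token (E : Execution init need C' C)
    (h : C'.Performs e (.ext (.recv s d (.token l, i)))) :
    e.proc = d ∧ e.thread = .token l ∧ ∃ k T, (E.rounds d l)[k]? = some T ∧ e = E.tev d l k 0 := by
  cases ht : e.thread with
  | spec t =>
    obtain ⟨b, a, T, j, hb, hj, he, -⟩ := exists_ev (E := E) h ht
    exact absurd (List.mem_of_getElem? hj) hb.2.2.not_recv_token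
  | token l' =>
    rcases exists_tev (E := E) h ht with ⟨h₀, hp, i, h⟩ | ⟨k, T, j, hT, hj, he⟩
    · simp at h
    · obtain ⟨rfl, h₃, h₄⟩ := (roundBlock_of_getElem? hT).of_recv hj
      obtain rfl : l = l' := by simpa using h₄
      subst h₃
      exact ⟨rfl, rfl, k, T, hT, he⟩

/-- The network model does not itself place a receive at its destination; the program does. This
lets the per-process `validMessages` yield `recv_inj`. -/
theorem proc_of_recv (E : Execution init need C' C)
    {m : TMsg Upd L} (h : C'.Performs e (.ext (.recv s d m))) : e.proc = d := by
  obtain ⟨m, i⟩ := m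
  cases m with
  | message u lo =>
    obtain ⟨b, T, -, -, rfl, hp, -⟩ := E.exists_ev_of_recv_message h
    exact hp
  | token l => exact (E.exists_tev_of_recv_token h).1
  | ack =>
    obtain ⟨b, u, l, T, j, -, -, rfl, hp, -⟩ := E.exists_ev_of_recv_ack h
    exact hp

theorem recv_inj (E : Execution init need C' C)
    {m : TMsg Upd L} (h : C'.Performs e (.ext (.recv s d m)))
    (h' : C'.Performs f (.ext (.recv s d m))) : e = f :=
  (E.validMessages d e ⟨⟨_, h⟩, E.proc_of_recv h⟩ f ⟨⟨_, h'⟩, E.proc_of_recv h'⟩ s d m).2 h h'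

end Messages

end Execution

/-- A strictly monotone total relation on a bounded set of natural numbers is not increasing. -/
theorem le_of_strictMono_rel {S : ℕ → Prop} {R : ℕ → ℕ → Prop} {N : ℕ} (hN : ∀ k, S k → k < N)
    (hR : ∀ k, S k → ∃ k', R k k') (hS : ∀ k k', R k k' → S k')
    (hmono : ∀ k₁ k₂ k₁' k₂', R k₁ k₁' → R k₂ k₂' → k₁ < k₂ → k₁' < k₂') {k k' : ℕ}
    (h : R k k') : k' ≤ k := by
  -- If `k < k'`, then monotonicity makes `k'` increase as well, and iteration would climb past `N`;
  -- hence induction on the distance to `N`.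
  induction hm : N - k using Nat.strong_induction_on generalizing k k' with
  | _ m ih =>
    by_contra! hlt
    have hk' := hS _ _ h
    obtain ⟨k'', h''⟩ := hR _ hk'
    have h₁ := hmono _ _ _ _ h h'' hlt
    have h₂ := hN _ hk'
    exact absurd (ih (N - k') (by omega) h'' rfl) (by omega)

namespace Execution

variable {n : ℕ} {Var Val Upd L : Type*} {init : Fin n → Var → Val}
  {need : Fin n → L → Bool} {C' : Computation (Fin n) (TThr L) (TOp n Var Val Upd L)}
  {C : Computation (Fin n) SThr (SOp Var Val Upd L)} (E : Execution init need C' C)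

/-! ### Acknowledgements -/

/-- The labelled broadcast at position `k` of the main thread of `p`. -/
def LabelledAt (p : Fin n) (k : ℕ) (u : Upd) (l : L) (T : List (TOp n Var Val Upd L)) : Prop :=
  E.At ⟨p, .m, k⟩ (.ext (.bcast u (some l))) T

/-- The acknowledgement by `d` of the `k`-th broadcast of `p` is received during the `k'`-th one. -/
def AckedIn (p d : Fin n) (k k' : ℕ) : Prop :=
  ∃ (u : Upd) (l : L) (T : List (TOp n Var Val Upd L)) (u' : Upd) (l' : L)
    (T' : List (TOp n Var Val Upd L)) (D : Event (Fin n) SThr) (TD : List (TOp n Var Val Upd L))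
    (i i₁ i₂ j j' : ℕ), E.LabelledAt p k u l T ∧ E.LabelledAt p k' u' l' T' ∧
    E.At D (.ext (.deliver u (some l))) TD ∧ D.proc = d ∧ D.thread = .d ∧
    T[j]? = some (.ext (.send p d (.message u (some l), i))) ∧
    TD[0]? = some (.ext (.recv p d (.message u (some l), i))) ∧
    TD[1]? = some (.ext (.send d p (.ack, i₁))) ∧
    i₁ = i₂ ∧ T'[j']? = some (.ext (.recv d p (.ack, i₂)))

variable {E}
variable {b b₁ b₂ : Event (Fin n) SThr} {u : Upd} {l : L} {T : List (TOp n Var Val Upd L)}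

/-- An acknowledgement does not name its update, so at this stage it is only known that some
labelled broadcast `k'` of `p` consumes it. -/
theorem exists_ack {p d : Fin n} {k i j : ℕ} (h : E.LabelledAt p k u l T)
    (hj : T[j]? = some (.ext (.send p d (.message u (some l), i)))) :
    ∃ e, C'.Performs e (.ext (.recv p d (.message u (some l), i))) ∧
    ∃ k' u' l' T' j', E.AckedIn p d k k' ∧ E.LabelledAt p k' u' l' T' ∧
      (∃ i', T'[j']? = some (.ext (.recv d p (.ack, i')))) ∧
      HappensBefore C' e (E.ev ⟨p, .m, k'⟩ j') := by
  obtain ⟨e, he⟩ := (E.recv_iff_send _ _ _).2 ⟨_, h.performs hj⟩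
  obtain ⟨D, TD, hD, h₀, rfl, hp, ht⟩ := E.exists_ev_of_recv_message he
  subst hp
  obtain ⟨i', h₁⟩ := hD.2.2.exists_send_ack h₀
  obtain ⟨c, hc⟩ := (E.recv_iff_send _ _ _).2 ⟨_, hD.performs h₁⟩
  obtain ⟨⟨p', t', k'⟩, u', l', T', j', hb', hj', rfl, rfl, rfl⟩ := E.exists_ev_of_recv_ack hc
  exact ⟨_, he, k', u', l', T', j', ⟨u, l, T, u', l', T', D, TD, i, i', i', j, j', h, hb', hD, rfl,
    ht, hj, h₀, h₁, rfl, hj'⟩, hb', ⟨i', hj'⟩,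
    (hD.hb_of_lt h₀ h₁ zero_lt_one).trans (hb_of_message (hD.performs h₁) hc)⟩

/-- FIFO on the channel from `p` to `d` orders the two deliveries, program order at `d` orders the
acknowledgements, and FIFO on the channel back orders their receipts. -/
theorem AckedIn.lt {p d : Fin n} {k₁ k₂ k₁' k₂' : ℕ} (h₁ : E.AckedIn p d k₁ k₁')
    (h₂ : E.AckedIn p d k₂ k₂') (hlt : k₁ < k₂) : k₁' < k₂' := by
  obtain ⟨u, l, T, u', l', T', D, TD, i, i₁, _, j, j', hT, hT', hD, rfl, hd, hj, h₀, h₁, rfl, hj'⟩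
    := h₁
  obtain ⟨v, m, S, v', m', S', F, SF, a, a₁, _, c, c', gT, gT', gD, gp, gd, gj, g₀, g₁, rfl, gj'⟩
    := h₂
  have hb₁ : HappensBefore C' (E.ev D 0) (E.ev F 0) :=
    hb_of_fifo (hD.performs h₀) (gD.performs g₀) (hT.performs hj) (gT.performs gj) rfl rfl
      (hT.idx_ev_lt hj rfl rfl hlt)
  have hidx := E.idx_lt_of_hb hb₁ gp.symm (by simp [ev, hd, gd])
  have hDF : D.idx < F.idx := by
    rcases gD.lt_of_ev_lt g₀ gp.symm (hd.trans gd.symm) hidx with h | h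
    · exact h
    · omega
  have hb₂ : HappensBefore C' (E.ev ⟨p, .m, k₁'⟩ j') (E.ev ⟨p, .m, k₂'⟩ c') :=
    hb_of_fifo (hT'.performs hj') (gT'.performs gj') (hD.performs h₁) (gD.performs g₁) gp.symm
      (by simp [ev, hd, gd]) (hD.idx_ev_lt h₁ gp.symm (hd.trans gd.symm) hDF)
  rcases gT'.lt_of_ev_lt (b := ⟨p, .m, k₁'⟩) gj' rfl rfl (E.idx_lt_of_hb hb₂ rfl rfl) with h | ⟨h, hjc⟩
  · exact h
  -- Both acknowledgements would be consumed by one broadcast, which takes only one from `d`.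
  · obtain rfl : k₁' = k₂' := h
    obtain ⟨-, rfl⟩ := hT'.inj gT'
    obtain ⟨hl, e₁⟩ := List.getElem?_eq_some_iff.1 hj'
    obtain ⟨hl', e₂⟩ := List.getElem?_eq_some_iff.1 gj'
    exact absurd e₂ (List.pairwise_iff_getElem.1 hT'.2.2.pairwise_recv_ack j' c' hl hl' hjc
      _ _ _ _ e₁)

/-- Every acknowledgement sent is received, so the relation is total on the finitely many labelled
broadcasts of `p`, and `le_of_strictMono_rel` applies. -/
theorem AckedIn.le {p d : Fin n} {k k' : ℕ} (h : E.AckedIn p d k k') : k' ≤ k := by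
  refine le_of_strictMono_rel (S := fun k => ∃ u l T, E.LabelledAt p k u l T)
    (R := E.AckedIn p d) (N := (C p .m).length) ?_ ?_ ?_ ?_ h
  · rintro k ⟨u, l, T, h⟩
    exact (List.getElem?_eq_some_iff.1 h.1).1
  · rintro k ⟨u, l, T, h⟩
    obtain ⟨i, hi⟩ := h.2.2.exists_send_message d
    obtain ⟨j, hj⟩ := List.mem_iff_getElem?.1 hi
    obtain ⟨_, _, k', _, _, _, _, hk', _⟩ := exists_ack h hj
    exact ⟨k', hk'⟩
  · rintro k k' ⟨u, l, T, u', l', T', D, TD, i, i₁, i₂, j, j', _, h, _⟩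
    exact ⟨u', l', T', h⟩
  · intro k₁ k₂ k₁' k₂' h₁ h₂ hlt
    exact h₁.lt h₂ hlt

/-- A labelled update is received by every process before its broadcast resets `needToken`. -/
theorem hb_of_recv {e : Event (Fin n) (TThr L)} {d : Fin n} {i j r w : ℕ}
    (h : E.At b (.ext (.bcast u (some l))) T) (hc : SpecBlock.Critical l T r w)
    (hj : T[j]? = some (.ext (.send b.proc d (.message u (some l), i))))
    (he : C'.Performs e (.ext (.recv b.proc d (.message u (some l), i)))) :
    HappensBefore C' e (E.ev b (w + 1)) := by
  have ht := E.thread_bcast _ _ _ h.1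
  obtain ⟨p, t, k⟩ := b
  obtain rfl : t = .m := ht
  obtain ⟨e', he', k', u', l', T', j', hk, hb', ⟨i', hj'⟩, hb⟩ := exists_ack (E := E) h hj
  obtain rfl := E.recv_inj he he'
  obtain ⟨i₃, hw⟩ := hc.write_need
  refine hb.trans ?_
  -- Either an earlier broadcast consumed the acknowledgement, or this one did, before shutting its
  -- door.
  rcases hk.le.lt_or_eq with hlt | rfl
  · exact hb'.hb_of_idx_lt hj' h hw rfl rfl hlt
  · obtain ⟨-, rfl⟩ := hb'.inj h
    exact hb'.hb_of_lt hj' hw (Nat.lt_succ_of_lt (hc.of_recv _ _ _ _ hj'))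

/-! ### The handshake between a broadcast and the token thread -/

variable (E) in
/-- The labelled broadcast `b` finds its door open in the state that the `k`-th round of the token
thread has produced. -/
def OpenedBy (b : Event (Fin n) SThr) (l : L) (r k : ℕ) : Prop :=
  (∃ T, (E.rounds b.proc l)[k]? = some T ∧
    ∃ i, T[2]? = some (.write (.doorOpen l) (.flag true, i)) ∧
    C'.Performs (E.tev b.proc l k 2) (.write (.doorOpen l) (.flag true, i)) ∧
    HappensBefore C' (E.tev b.proc l k 2) (E.ev b r)) ∧
  ∀ w' ∈ C'.opsOf b.proc, ∀ v', C'.Performs w' (.write (.doorOpen l) v') →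
    E.lt b.proc w' (E.ev b r) → ¬ E.lt b.proc (E.tev b.proc l k 2) w'

/-- The door is initially shut and broadcasts never write TRUE to it, so the value read stems from a
round of the token thread. -/
theorem exists_openedBy {r w : ℕ} {a : SOp Var Val Upd L}
    (h : E.At b a T) (hc : SpecBlock.Critical l T r w) : ∃ k, E.OpenedBy b l r k := by
  obtain ⟨i, hr⟩ := hc.read_door
  have hp := h.performs hr
  rcases E.validVars b.proc (E.ev b r) ⟨⟨_, hp⟩, rfl⟩ _ _ hp with
    ⟨e, he, hw, -, hmax⟩ | ⟨h₀, -⟩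
  · cases ht : e.thread with
    | spec t =>
      obtain ⟨b', a', T', j, hb', hj, -, -⟩ := exists_ev (E := E) hw ht
      exact absurd (List.mem_of_getElem? hj) hb'.2.2.not_write_doorOpen_true
    | token l' =>
      rcases exists_tev (E := E) hw ht with ⟨-, -, _, h⟩ | ⟨k, S, j, hS, hj, hek⟩
      · simp at h
      · obtain ⟨rfl, hl, -⟩ := (roundBlock_of_getElem? hS).of_write_door hj
        obtain rfl : l = l' := by simpa using hl
        rw [he.2] at hek hS
        subst hek
        exact ⟨k, ⟨S, hS, i, hj, hw, hb_of_writesInto rfl hw hp⟩, hmax⟩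
  · simp [tknInit] at h₀

theorem exists_ev_of_write_needToken_false {e : Event (Fin n) (TThr L)} {i : ℕ}
    (h : C'.Performs e (.write (.needToken l) (.flag false, i))) :
    ∃ b u T j, E.At b (.ext (.bcast u (some l))) T ∧
      T[j]? = some (.write (.needToken l) (.flag false, i)) ∧ e = E.ev b j := by
  cases ht : e.thread with
  | spec t =>
    obtain ⟨b, a, T, j, hb, hj, he, -⟩ := exists_ev (E := E) h ht
    obtain ⟨u, rfl⟩ := hb.2.2.of_write_needToken_false (List.mem_of_getElem? hj)
    exact ⟨b, u, T, j, hb, hj, he⟩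
  | token l =>
    rcases exists_tev (E := E) h ht with ⟨-, -, i, h⟩ | ⟨k, T, j, hT, hj, -⟩
    · simp at h
    · simpa using ((roundBlock_of_getElem? hT).of_write_door hj).2.1

/-- The round that opened the door for a broadcast does not find `needToken` reset before that
broadcast has reset it. -/
theorem OpenedBy.hb_tev {r w k f i : ℕ} {S : List (TOp n Var Val Upd L)}
    (ho : E.OpenedBy b l r k)
    (h : E.At b (.ext (.bcast u (some l))) T) (hc : SpecBlock.Critical l T r w)
    (hS : (E.rounds b.proc l)[k]? = some S) (hf : 2 < f)
    (hF : C'.Performs (E.tev b.proc l k f) (.read (.needToken l) (.flag false, i))) :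
    HappensBefore C' (E.ev b (w + 1)) (E.tev b.proc l k f) := by
  induction hm : b.idx using Nat.strong_induction_on generalizing b u T r w k f i S with
  | _ m ih =>
  subst hm
  set p := b.proc with hp
  obtain ⟨⟨S', hS', i₂, hW₂, hW, hWr⟩, hmax⟩ := ho
  obtain rfl := Option.some.inj (hS.symm.trans hS')
  obtain ⟨-, -, -, ⟨i₁, hG₁⟩, -⟩ := (roundBlock_of_getElem? hS).of_write_door hW₂
  have hG := performs_tev_of_le hW one_le_two hS hG₁
  have hGF := hb_tev_of_lt hG hF (by omega)
  have opG : E.tev p l k 1 ∈ C'.opsOf p := ⟨⟨_, hG⟩, rfl⟩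
  have opF : E.tev p l k f ∈ C'.opsOf p := ⟨⟨_, hF⟩, rfl⟩
  have opW : E.tev p l k 2 ∈ C'.opsOf p := ⟨⟨_, hW⟩, rfl⟩
  have ltGF := E.lt_of_hb hGF rfl rfl
  -- The round read TRUE at its position 1 and FALSE at `f`, so `needToken` was reset in between,
  -- whatever its initial value.
  have hcase : ∃ e ∈ C'.opsOf p, C'.Performs e (.write (.needToken l) (.flag false, i)) ∧
      E.lt p e (E.tev p l k f) ∧ ¬ E.lt p e (E.tev p l k 1) := by
    rcases E.validVars p _ opF _ _ hF with ⟨e, ope, he, hlt, hmax'⟩ | ⟨h₀, hno⟩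
    · refine ⟨e, ope, he, hlt, fun heG => ?_⟩
      rcases E.validVars p _ opG _ _ hG with ⟨e₂, ope₂, he₂, hlt₂, hmax₂⟩ | ⟨-, hno⟩
      · have hne : e ≠ e₂ := by
          rintro rfl
          simpa using he.inj he₂
        -- If `e` preceded the first read, the write of TRUE seen there would come after `e` and
        -- before the second read, so `e` would not be the most recent write.
        exact hmax' e₂ ope₂ _ he₂ (E.lt_trans ope₂ opG opF hlt₂ ltGF)
          (E.lt_of_not_lt ope₂ ope hne.symm (hmax₂ e ope _ he heG))
      · exact hno e ope _ he heG
    -- If the second read saw the initial value, so did the first, but they differ.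
    · exfalso
      rcases E.validVars p _ opG _ _ hG with ⟨e₂, ope₂, he₂, hlt₂, -⟩ | ⟨h₁, -⟩
      · exact hno e₂ ope₂ _ he₂ (E.lt_trans ope₂ opG opF hlt₂ ltGF)
      · have := congrArg Prod.fst h₀
        have := congrArg Prod.fst h₁
        simp_all [tknInit]
  obtain ⟨e, ope, he, heF, heG⟩ := hcase
  have hbe : HappensBefore C' e (E.tev p l k f) := hb_of_writesInto ope.2 he hF
  obtain ⟨b', u', T', j', h', hj', rfl⟩ := exists_ev_of_write_needToken_false (E := E) he
  obtain ⟨r', w', hc'⟩ := h'.2.2.exists_critical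
  obtain rfl := hc'.of_write_need _ _ hj'
  have hp' : b'.proc = b.proc := ope.2
  have ht : b.thread = b'.thread :=
    (E.thread_bcast _ _ _ h.1).trans (E.thread_bcast _ _ _ h'.1).symm
  obtain ⟨i₃, hw₃⟩ := hc.write_need
  rcases lt_trichotomy b.idx b'.idx with hlt | heq | hlt
  · exact (h.hb_of_idx_lt hw₃ h' hj' hp'.symm ht hlt).trans hbe
  · obtain rfl : b = b' := by
      cases b; cases b'; simp_all
    obtain ⟨-, rfl⟩ := h.inj h'
    obtain rfl : w = w' := Nat.succ_injective (hc'.of_write_need _ _ hw₃)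
    exact hbe
  -- The reset cannot stem from an earlier broadcast `b'`: the round `k'` that served `b'` ended
  -- after that reset, and it will turn out that `k' < k`, so the reset would precede the first read
  -- of round `k`.
  · exfalso
    obtain ⟨k', ho'⟩ := exists_openedBy h' hc'
    have ho'' := ho'
    obtain ⟨⟨S', hS', i₂', hW₂', hW', hWr'⟩, -⟩ := ho'
    obtain ⟨-, -, -, -, f', hf', hlen, i₄, hf₄⟩ := (roundBlock_of_getElem? hS').of_write_door hW₂'
    obtain ⟨_, hr⟩ := hc.read_door
    obtain ⟨_, hr'⟩ := hc'.read_door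
    obtain ⟨_, hd'⟩ := hc'.write_door
    have opD : E.ev b' w' ∈ C'.opsOf p := ⟨⟨_, h'.performs hd'⟩, hp'⟩
    have opW' : E.tev b'.proc l k' 2 ∈ C'.opsOf p := ⟨⟨_, hW'⟩, hp'⟩
    have hDr := E.lt_of_hb (h'.hb_of_idx_lt hd' h hr hp' ht.symm hlt) hp' rfl
    have hne : E.tev p l k 2 ≠ E.ev b' w' := by simp [tev, ev]
    -- `b'` shut the door before `b` read it, and no write to the door falls between its opening by
    -- round `k` and that read; so the shutting precedes this opening.
    have hDW := E.lt_of_not_lt opW opD hne (hmax _ opD _ (h'.performs hd') hDr)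
    have hWD := E.lt_of_hb (hWr'.trans (h'.hb_of_lt hr' hd' hc'.lt)) hp' hp'
    have hidx := E.idx_lt_of_lt opW' opW rfl (E.lt_trans opW' opD opW hWD hDW)
    rw [hp'] at hS'
    rw [hp', ← hp] at hidx
    have hk : k' < k := by
      rcases lt_of_offset_lt (getElem?_cons_rounds hS) (List.getElem?_eq_some_iff.1 hW₂).1 hidx
        with hk | hk <;> omega
    have hlt' := idx_tev_lt (j' := 1) hS' hf₄ hk
    -- Round `k'` did reach this read, because a later event of the same thread occurs.
    have hF' := performs_tev hG rfl rfl hS' hf₄ hlt'.le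
    have := ih b'.idx hlt (S := S') ho'' h' hc' (hp' ▸ hS') hf' (by rw [hp']; exact hF') rfl
    refine heG (E.lt_of_hb (this.trans ?_) hp' rfl)
    rw [hp']
    exact hb_of_idx_lt hF' hG rfl rfl hlt'

/-! ### The tour of the token -/

variable (E) in
/-- The token that the process of `e` receives in `e` is next received in `f`. -/
def TokenStep (l : L) (e f : Event (Fin n) (TThr L)) : Prop :=
  ∃ p k T j q i, (E.rounds p l)[k]? = some T ∧ j + 1 = T.length ∧ 0 < j ∧ e = E.tev p l k 0 ∧
    C'.Performs (E.tev p l k j) (.ext (.send p q (.token l, i))) ∧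
    C'.Performs f (.ext (.recv p q (.token l, i)))

/-- Existence of the rounds matters: their traces are nonempty, so different rounds start at
different positions. -/
theorem tev_zero_inj {p p' : Fin n} {k k' : ℕ} {T T' : List (TOp n Var Val Upd L)}
    (hT : (E.rounds p l)[k]? = some T) (hT' : (E.rounds p' l)[k']? = some T')
    (h : E.tev p l k 0 = E.tev p' l k' 0) : p = p' ∧ k = k' := by
  simp only [tev, Event.mk.injEq, true_and] at h
  obtain ⟨rfl, h⟩ := h
  obtain ⟨q, i, h₀⟩ := (roundBlock_of_getElem? hT).getElem?_zero
  obtain ⟨q', i', h₀'⟩ := (roundBlock_of_getElem? hT').getElem?_zero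
  have := (eq_of_offset_eq (getElem?_cons_rounds hT) (List.getElem?_eq_some_iff.1 h₀).1
    (getElem?_cons_rounds hT') (List.getElem?_eq_some_iff.1 h₀').1 h).1
  exact ⟨rfl, by omega⟩

/-- The only send of a round is its last operation, and a message is received at most once. -/
theorem rightUnique_tokenStep : Relator.RightUnique (E.TokenStep l) := by
  rintro e f g ⟨p, k, T, j, q, i, hT, hj, -, rfl, hs, hr⟩
    ⟨p', k', T', j', q', i', hT', hj', -, he, hs', hr'⟩
  obtain ⟨rfl, rfl⟩ := tev_zero_inj hT hT' he
  obtain rfl := Option.some.inj (hT.symm.trans hT')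
  obtain rfl : j = j' := by omega
  have := hs.inj hs'
  simp only [Op.ext.injEq, MsgOp.send.injEq, Prod.mk.injEq, true_and] at this
  obtain ⟨rfl, rfl⟩ := this
  exact E.recv_inj hr hr'

theorem TokenStep.hb {e f : Event (Fin n) (TThr L)} (h : E.TokenStep l e f) :
    HappensBefore C' e f := by
  obtain ⟨p, k, T, j, q, i, hT, hj, hj₀, rfl, hs, hr⟩ := h
  obtain ⟨_, _, h₀⟩ := (roundBlock_of_getElem? hT).getElem?_zero
  exact (hb_tev_of_lt (performs_tev_of_le hs hj₀.le hT h₀) hs hj₀).trans (hb_of_message hs hr)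

theorem hb_or_eq_of_reflTransGen {e f : Event (Fin n) (TThr L)}
    (h : Relation.ReflTransGen (E.TokenStep l) e f) : e = f ∨ HappensBefore C' e f := by
  induction h with
  | refl => exact .inl rfl
  | tail _ h ih =>
    rcases ih with rfl | ih
    · exact .inr h.hb
    · exact .inr (ih.trans h.hb)

theorem finite_tokenOps (C' : Computation (Fin n) (TThr L) (TOp n Var Val Upd L)) (l : L) :
    {e | e ∈ C'.ops ∧ e.thread = .token l}.Finite := by
  refine Set.Finite.subset (Set.finite_iUnion (ι := Fin n) fun p =>
    Set.Finite.image (fun i => (⟨p, .token l, i⟩ : Event (Fin n) (TThr L)))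
      (Set.finite_Iio (C' p (.token l)).length)) ?_
  rintro ⟨p, t, i⟩ ⟨⟨o, ho⟩, rfl⟩
  exact Set.mem_iUnion.2 ⟨p, i, (List.getElem?_eq_some_iff.1 ho).1, rfl⟩

/-- `e` receives the token from the process that created it. -/
def TokenRoot (l : L) (e : Event (Fin n) (TThr L)) : Prop :=
  ∃ p q i s, p.1 = 0 ∧ s.proc = p ∧ s.thread = .token l ∧ s.idx = 0 ∧
    C'.Performs s (.ext (.send p q (.token l, i))) ∧ C'.Performs e (.ext (.recv p q (.token l, i)))

/-- The token thread of process 0 has only one event at position 0, so only one message creates the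
token. -/
theorem TokenRoot.eq {e f : Event (Fin n) (TThr L)} (h : TokenRoot (C' := C') l e)
    (h' : TokenRoot (C' := C') l f) (E : Execution init need C' C) : e = f := by
  obtain ⟨p, q, i, ⟨p', t, k⟩, hp, rfl, rfl, rfl, hs, hr⟩ := h
  obtain ⟨p'', q', i', ⟨p', t, k⟩, hp', rfl, rfl, rfl, hs', hr'⟩ := h'
  dsimp only at hp hp' hs hs' hr hr'
  obtain rfl := Fin.ext (hp.trans hp'.symm)
  have := hs.inj hs'
  simp only [Op.ext.injEq, MsgOp.send.injEq, Prod.mk.injEq, true_and] at this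
  obtain ⟨rfl, rfl⟩ := this
  exact E.recv_inj hr hr'

variable (E) in
-- Trace the token backwards: it was sent either initially by process 0 or at the end of a round,
-- which itself began with a receipt. Each step back goes down in happens-before.
theorem exists_tokenRoot {e : Event (Fin n) (TThr L)} {s d : Fin n} {i : ℕ}
    (h : C'.Performs e (.ext (.recv s d (.token l, i)))) :
    ∃ f, TokenRoot (C' := C') l f ∧ Relation.ReflTransGen (E.TokenStep l) f e := by
  have : IsStrictOrder (Event (Fin n) (TThr L)) (HappensBefore C') :=
    -- Acyclicity of happens-before, together with the finiteness of the set of token events, makes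
    -- the descent well-founded.
    { irrefl := E.not_hb_self, trans := fun _ _ _ => Relation.TransGen.trans }
  have hwf := (finite_tokenOps C' l).wellFoundedOn (r := HappensBefore C')
  have key : ∀ e, e ∈ {e | e ∈ C'.ops ∧ e.thread = .token l} → ∀ s d i,
      C'.Performs e (.ext (.recv s d (.token l, i))) →
      ∃ f, TokenRoot (C' := C') l f ∧ Relation.ReflTransGen (E.TokenStep l) f e := by
    intro e he
    refine hwf.induction (P := fun e => ∀ s d i, C'.Performs e (.ext (.recv s d (.token l, i))) →
      ∃ f, TokenRoot (C' := C') l f ∧ Relation.ReflTransGen (E.TokenStep l) f e) he ?_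
    clear e he
    intro e he ih s d i h
    obtain ⟨a, ha⟩ := (E.recv_iff_send _ _ _).1 ⟨_, h⟩
    obtain ⟨hp, ht, ⟨h₀, hs⟩ | ⟨k, T, j, hT, hj, hj₁, rfl⟩⟩ := E.exists_tev_of_send_token ha
    · exact ⟨e, ⟨s, d, i, a, hs, hp, ht, h₀, ha, h⟩, .refl⟩
    · have hstep : E.TokenStep l (E.tev s l k 0) e :=
        ⟨s, k, T, j, d, i, hT, hj, by omega, rfl, ha, h⟩
      obtain ⟨q, i', hq⟩ := (roundBlock_of_getElem? hT).getElem?_zero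
      have hq' := performs_tev_of_le ha j.zero_le hT hq
      obtain ⟨f, hf, hfe⟩ := ih _ ⟨⟨_, hq'⟩, rfl⟩ hstep.hb _ _ _ hq'
      exact ⟨f, hf, hfe.tail hstep⟩
  exact key e ⟨⟨_, h⟩, (E.exists_tev_of_recv_token h).2.1⟩ s d i h

/-- A nontrivial chain of token steps leaves the round through its final send, so the whole round
precedes the end of the chain. -/
theorem hb_of_reflTransGen_of_ne {p : Fin n} {k : ℕ} {f : Event (Fin n) (TThr L)}
    {T : List (TOp n Var Val Upd L)} (hT : (E.rounds p l)[k]? = some T)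
    (h : Relation.ReflTransGen (E.TokenStep l) (E.tev p l k 0) f) (hne : E.tev p l k 0 ≠ f) :
    ∃ j o, j + 1 = T.length ∧ C'.Performs (E.tev p l k j) o ∧
      HappensBefore C' (E.tev p l k j) f := by
  obtain h | ⟨g, ⟨p', k', T', j, q, i, hT', hj, -, he, hs, hr⟩, hg⟩ := h.cases_head
  · exact absurd h hne
  obtain ⟨rfl, rfl⟩ := tev_zero_inj hT hT' he
  obtain rfl := Option.some.inj (hT.symm.trans hT')
  refine ⟨j, _, hj, hs, ?_⟩
  rcases hb_or_eq_of_reflTransGen hg with rfl | hg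
  · exact hb_of_message hs hr
  · exact (hb_of_message hs hr).trans hg

/-- Of any two rounds, one passes the token on before the other receives it. -/
theorem hb_or_hb_of_rounds {p p' : Fin n} {k k' : ℕ} {T T' : List (TOp n Var Val Upd L)}
    {j j' : ℕ} {o o' : TOp n Var Val Upd L}
    (hT : (E.rounds p l)[k]? = some T) (h : C'.Performs (E.tev p l k j) o)
    (hT' : (E.rounds p' l)[k']? = some T') (h' : C'.Performs (E.tev p' l k' j') o')
    (hne : p ≠ p') :
    (∃ j o, j + 1 = T.length ∧ C'.Performs (E.tev p l k j) o ∧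
      HappensBefore C' (E.tev p l k j) (E.tev p' l k' 0)) ∨
    (∃ j o, j + 1 = T'.length ∧ C'.Performs (E.tev p' l k' j) o ∧
      HappensBefore C' (E.tev p' l k' j) (E.tev p l k 0)) := by
  obtain ⟨q, i, h₀⟩ := (roundBlock_of_getElem? hT).getElem?_zero
  obtain ⟨q', i', h₀'⟩ := (roundBlock_of_getElem? hT').getElem?_zero
  obtain ⟨f, hf, hfe⟩ := E.exists_tokenRoot (performs_tev_of_le h j.zero_le hT h₀)
  obtain ⟨f', hf', hfe'⟩ := E.exists_tokenRoot (performs_tev_of_le h' j'.zero_le hT' h₀')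
  obtain rfl := hf.eq hf' E
  have hne' : E.tev p l k 0 ≠ E.tev p' l k' 0 := by simp [tev, hne]
  -- Both receipts are reached from the same root by a right-unique relation, so one is reached from
  -- the other.
  rcases Relation.ReflTransGen.total_of_right_unique rightUnique_tokenStep hfe hfe' with h | h
  · exact .inl (hb_of_reflTransGen_of_ne hT h hne')
  · exact .inr (hb_of_reflTransGen_of_ne hT' h hne'.symm)

/-! ### Mutual exclusion -/

/-- The reset of `needToken` by `b₁` precedes the end of the spinning of round `k₁`, hence its send
of the token, the start of round `k₂`, the opening of the door there, and the read of that door by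
`b₂`. -/
theorem OpenedBy.hb_of_hb {r₁ w₁ r₂ k₁ k₂ j : ℕ} {o : TOp n Var Val Upd L}
    {S₁ : List (TOp n Var Val Upd L)} (ho₁ : E.OpenedBy b₁ l r₁ k₁) (ho₂ : E.OpenedBy b₂ l r₂ k₂)
    (h : E.At b₁ (.ext (.bcast u (some l))) T) (hc : SpecBlock.Critical l T r₁ w₁)
    (hS : (E.rounds b₁.proc l)[k₁]? = some S₁) (hj : j + 1 = S₁.length)
    (hs : C'.Performs (E.tev b₁.proc l k₁ j) o)
    (hb : HappensBefore C' (E.tev b₁.proc l k₁ j) (E.tev b₂.proc l k₂ 0)) :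
    HappensBefore C' (E.ev b₁ (w₁ + 1)) (E.ev b₂ r₂) := by
  have ho := ho₁
  obtain ⟨⟨S, hS', i, hW, -, -⟩, -⟩ := ho₁
  obtain rfl := Option.some.inj (hS.symm.trans hS')
  obtain ⟨⟨S₂, hS₂, i₂, hW₂, hW₂', hb₂⟩, -⟩ := ho₂
  obtain ⟨-, -, -, -, f, hf, hlen, i', hF⟩ := (roundBlock_of_getElem? hS).of_write_door hW
  have hF' := performs_tev_of_le hs (by omega) hS hF
  obtain ⟨q, i₀, h₀⟩ := (roundBlock_of_getElem? hS₂).getElem?_zero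
  have h₀' := performs_tev_of_le hW₂' (Nat.zero_le 2) hS₂ h₀
  exact (((ho.hb_tev h hc hS hf hF').trans (hb_tev_of_lt hF' hs (by omega))).trans hb).trans
    ((hb_tev_of_lt h₀' hW₂' two_pos).trans hb₂)

/-- Of any two broadcasts with the same label, one has reset `needToken` before the other finds its
door open. -/
theorem hb_or_hb_of_bcasts {u₁ u₂ : Upd} {T₁ T₂ : List (TOp n Var Val Upd L)} {r₁ w₁ r₂ w₂ : ℕ}
    (h₁ : E.At b₁ (.ext (.bcast u₁ (some l))) T₁) (hc₁ : SpecBlock.Critical l T₁ r₁ w₁)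
    (h₂ : E.At b₂ (.ext (.bcast u₂ (some l))) T₂) (hc₂ : SpecBlock.Critical l T₂ r₂ w₂)
    (hne : b₁ ≠ b₂) :
    HappensBefore C' (E.ev b₁ (w₁ + 1)) (E.ev b₂ r₂) ∨
    HappensBefore C' (E.ev b₂ (w₂ + 1)) (E.ev b₁ r₁) := by
  by_cases hp : b₁.proc = b₂.proc
  · have ht : b₁.thread = b₂.thread :=
      (E.thread_bcast _ _ _ h₁.1).trans (E.thread_bcast _ _ _ h₂.1).symm
    obtain ⟨_, g₁⟩ := hc₁.write_need
    obtain ⟨_, g₂⟩ := hc₂.write_need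
    obtain ⟨_, g₁'⟩ := hc₁.read_door
    obtain ⟨_, g₂'⟩ := hc₂.read_door
    rcases lt_trichotomy b₁.idx b₂.idx with h | h | h
    · exact .inl (h₁.hb_of_idx_lt g₁ h₂ g₂' hp ht h)
    · exact absurd (by cases b₁; cases b₂; simp_all) hne
    · exact .inr (h₂.hb_of_idx_lt g₂ h₁ g₁' hp.symm ht.symm h)
  · obtain ⟨k₁, ho₁⟩ := exists_openedBy h₁ hc₁
    obtain ⟨k₂, ho₂⟩ := exists_openedBy h₂ hc₂
    have ho₁' := ho₁
    have ho₂' := ho₂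
    obtain ⟨⟨S₁, hS₁, _, -, hW₁, -⟩, -⟩ := ho₁'
    obtain ⟨⟨S₂, hS₂, _, -, hW₂, -⟩, -⟩ := ho₂'
    rcases hb_or_hb_of_rounds hS₁ hW₁ hS₂ hW₂ hp with ⟨j, o, hj, hs, hb⟩ | ⟨j, o, hj, hs, hb⟩
    · exact .inl (ho₁.hb_of_hb ho₂ h₁ hc₁ hS₁ hj hs hb)
    · exact .inr (ho₂.hb_of_hb ho₁ h₂ hc₂ hS₂ hj hs hb)

end Execution

namespace Execution

variable {n : ℕ} {Var Val Upd L : Type*} {init : Fin n → Var → Val}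
  {need : Fin n → L → Bool} {C' : Computation (Fin n) (TThr L) (TOp n Var Val Upd L)}
  {C : Computation (Fin n) SThr (SOp Var Val Upd L)} {E : Execution init need C' C}

/-! ### The interpretation satisfies partial-order broadcast -/

theorem ev_zero_mem_opsOf {b : Event (Fin n) SThr} {p : Fin n} (h : b ∈ C.opsOf p) :
    E.ev b 0 ∈ C'.opsOf p := by
  obtain ⟨⟨a, ha⟩, hp⟩ := h
  obtain ⟨T, hT⟩ := exists_at (E := E) ha
  obtain ⟨o, ho⟩ := hT.getElem?_zero
  exact ⟨⟨o, hT.performs ho⟩, hp⟩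

theorem ev_zero_inj {b b' : Event (Fin n) SThr} (h : b ∈ C.ops) (h' : b' ∈ C.ops)
    (e : E.ev b 0 = E.ev b' 0) : b = b' := by
  obtain ⟨a, ha⟩ := h
  obtain ⟨a', ha'⟩ := h'
  obtain ⟨T, hT⟩ := exists_at (E := E) ha
  obtain ⟨T', hT'⟩ := exists_at (E := E) ha'
  obtain ⟨o, ho⟩ := hT.getElem?_zero
  obtain ⟨o', ho'⟩ := hT'.getElem?_zero
  exact (hT.ev_inj ho hT' ho' e).1

variable (E) in
/-- The order of the specification events of `p` that is induced by the first events of their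
implementations. -/
def specLt (p : Fin n) (e f : Event (Fin n) SThr) : Prop := E.lt p (E.ev e 0) (E.ev f 0)

theorem strictTotalOn_specLt (p : Fin n) : StrictTotalOn (C.opsOf p) (E.specLt p) :=
  ⟨fun _ ha => (E.strictTotal p).1 _ (ev_zero_mem_opsOf ha),
    fun _ ha _ hb _ hc => (E.strictTotal p).2.1 _ (ev_zero_mem_opsOf ha) _ (ev_zero_mem_opsOf hb) _
      (ev_zero_mem_opsOf hc),
    fun _ ha _ hb hne => (E.strictTotal p).2.2 _ (ev_zero_mem_opsOf ha) _ (ev_zero_mem_opsOf hb)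
      fun e => hne (ev_zero_inj ha.1 hb.1 e)⟩

theorem performs_ev_zero_write {b : Event (Fin n) SThr} {x : Var} {v : Val}
    (h : C.Performs b (.write x v)) :
    ∃ i, C'.Performs (E.ev b 0) (.write (.user x) (.val v, i)) := by
  obtain ⟨T, hT⟩ := exists_at (E := E) h
  obtain ⟨i, hi⟩ := hT.2.2.getElem?_zero_write
  exact ⟨i, hT.performs hi⟩

theorem exists_ev_of_write_user {e : Event (Fin n) (TThr L)} {x : Var} {v : TVal Val}
    (h : C'.Performs e (.write (.user x) v)) :
    ∃ b v', v.1 = .val v' ∧ C.Performs b (.write x v') ∧ e = E.ev b 0 := by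
  cases ht : e.thread with
  | spec t =>
    obtain ⟨b, a, T, j, hb, hj, he, -⟩ := exists_ev (E := E) h ht
    obtain ⟨rfl, v', hv, rfl⟩ := hb.2.2.of_write_user hj
    exact ⟨b, v', hv, hb.1, he⟩
  | token l =>
    rcases exists_tev (E := E) h ht with ⟨-, -, i, h⟩ | ⟨k, T, j, hT, hj, -⟩
    · simp at h
    · simpa using ((roundBlock_of_getElem? hT).of_write_door hj).2.1

/-- Replicas are written only by the one-event write subroutines, so the writes visible to a read
are the same at both levels. -/
theorem validVars_specLt (p : Fin n) : ValidVars C (init p) p (E.specLt p) := by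
  intro r hr x v h
  obtain ⟨T, hT⟩ := exists_at (E := E) h
  obtain ⟨i, hi⟩ := hT.2.2.getElem?_zero_read
  rcases E.validVars p _ (ev_zero_mem_opsOf hr) _ _ (hT.performs hi) with
    ⟨e, he, hw, hlt, hmax⟩ | ⟨h₀, hno⟩
  · obtain ⟨b, v', hv, hb, rfl⟩ := exists_ev_of_write_user (E := E) hw
    obtain rfl : v = v' := by simpa using hv
    refine .inl ⟨b, ⟨⟨_, hb⟩, he.2⟩, hb, hlt, fun w' hw' v' h' hlt' => ?_⟩
    obtain ⟨i', hi'⟩ := performs_ev_zero_write (E := E) h'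
    exact hmax _ (ev_zero_mem_opsOf hw') _ hi' hlt'
  · refine .inr ⟨by simpa [tknInit] using congrArg Prod.fst h₀, fun w' hw' v' h' hlt' => ?_⟩
    obtain ⟨i', hi'⟩ := performs_ev_zero_write (E := E) h'
    exact hno _ (ev_zero_mem_opsOf hw') _ hi' hlt'

theorem exists_bcast_of_deliver {D : Event (Fin n) SThr} {u : Upd} {lo : Option L}
    (h : C.Performs D (.ext (.deliver u lo))) :
    ∃ (b : Event (Fin n) SThr) (T : List (TOp n Var Val Upd L)) (i j : ℕ),
      E.At b (.ext (.bcast u lo)) T ∧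
      T[j]? = some (.ext (.send b.proc D.proc (.message u lo, i))) ∧
      C'.Performs (E.ev D 0) (.ext (.recv b.proc D.proc (.message u lo, i))) := by
  obtain ⟨TD, hTD⟩ := exists_at (E := E) h
  obtain ⟨s, i, h₀⟩ := hTD.2.2.getElem?_zero_deliver
  obtain ⟨e, he⟩ := (E.recv_iff_send _ _ _).1 ⟨_, hTD.performs h₀⟩
  obtain ⟨b, T, j, hb, hj, -, rfl, -⟩ := E.exists_ev_of_send_message he
  exact ⟨b, T, i, j, hb, hj, hTD.performs h₀⟩

theorem exists_deliver_of_bcast {b : Event (Fin n) SThr} {u : Upd} {lo : Option L}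
    {T : List (TOp n Var Val Upd L)} (p : Fin n)
    (h : E.At b (.ext (.bcast u lo)) T) : ∃ D ∈ C.opsOf p, C.Performs D (.ext (.deliver u lo)) := by
  obtain ⟨i, hi⟩ := h.2.2.exists_send_message p
  obtain ⟨j, hj⟩ := List.mem_iff_getElem?.1 hi
  obtain ⟨e, he⟩ := (E.recv_iff_send _ _ _).2 ⟨_, h.performs hj⟩
  obtain ⟨D, TD, hD, -, -, hp, -⟩ := E.exists_ev_of_recv_message he
  exact ⟨D, ⟨⟨_, hD.1⟩, hp⟩, hD.1⟩

/-- Both receipts stem from the same broadcast, which sends only one message to this process, and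
that message is received only once. -/
theorem deliver_unique (hu : UniqueUpdates C) {D F : Event (Fin n) SThr} {u : Upd} {lo : Option L}
    (hD : C.Performs D (.ext (.deliver u lo))) (hF : C.Performs F (.ext (.deliver u lo)))
    (hp : D.proc = F.proc) (E : Execution init need C' C) : D = F := by
  obtain ⟨b, T, i, j, hb, hj, hD'⟩ := exists_bcast_of_deliver (E := E) hD
  obtain ⟨b', T', i', j', hb', hj', hF'⟩ := exists_bcast_of_deliver (E := E) hF
  obtain rfl := hu _ _ _ _ hb.1 hb'.1
  obtain ⟨-, rfl⟩ := hb.inj hb'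
  rw [hp] at hj hD'
  obtain ⟨hl, e⟩ := List.getElem?_eq_some_iff.1 hj
  obtain ⟨hl', e'⟩ := List.getElem?_eq_some_iff.1 hj'
  have hpw := List.pairwise_iff_getElem.1 hb.2.2.pairwise_send_message
  obtain rfl : j = j' := by
    rcases lt_trichotomy j j' with h | h | h
    · exact absurd e' (hpw _ _ hl hl' h _ _ _ _ _ _ _ _ e)
    · exact h
    · exact absurd e (hpw _ _ hl' hl h _ _ _ _ _ _ _ _ e')
  obtain rfl : i = i' := by simpa using hj.symm.trans hj'
  exact ev_zero_inj ⟨_, hD⟩ ⟨_, hF⟩ (E.recv_inj hD' hF')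

theorem validBcasts_specLt (hu : UniqueUpdates C) (p : Fin n) : ValidBcasts C p (E.specLt p) := by
  refine ⟨fun e he f hf u l hD hB hlt => ?_, fun e he f hf u l hD hF =>
    deliver_unique hu hD hF (he.2.trans hf.2.symm) E⟩
  obtain ⟨b, T, i, j, hb, hj, hD'⟩ := exists_bcast_of_deliver (E := E) hD
  obtain rfl := hu _ _ _ _ hb.1 hB
  have hb₁ := hb_of_message (hb.performs hj) hD'
  obtain ⟨o, ho⟩ := hb.getElem?_zero
  have hb₂ : HappensBefore C' (E.ev b 0) (E.ev e 0) := by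
    -- The first event of an unlabelled broadcast may itself be the send in question.
    rcases Nat.eq_zero_or_pos j with rfl | h₀
    · exact hb₁
    · exact (hb.hb_of_lt ho hj h₀).trans hb₁
  exact E.lt_asymm (ev_zero_mem_opsOf he) (ev_zero_mem_opsOf hf) hlt (E.lt_of_hb hb₂ hf.2 he.2)

theorem extends_specLt (hu : UniqueUpdates C) (p : Fin n) :
    Extends (C.opsOf p) (E.specLt p) fun e f => C.Prog e f ∨ DelOrder C e f := by
  intro e he f hf h
  refine E.lt_of_hb ?_ he.2 hf.2
  rcases h with ⟨⟨a, ha⟩, ⟨a', ha'⟩, hp, ht, hlt⟩ |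
    ⟨u₁, l₁, u₂, l₂, h₁, h₂, a, b, ha, hb, -, -, hp, ht, hlt⟩
  · obtain ⟨T, hT⟩ := exists_at (E := E) ha
    obtain ⟨T', hT'⟩ := exists_at (E := E) ha'
    obtain ⟨o, ho⟩ := hT.getElem?_zero
    obtain ⟨o', ho'⟩ := hT'.getElem?_zero
    exact hT.hb_of_idx_lt ho hT' ho' hp ht hlt
  -- Delivery order is FIFO order, once uniqueness of updates has identified the given broadcasts
  -- with the senders of the messages received.
  · obtain ⟨a', T, i, j, ha', hj, h₁'⟩ := exists_bcast_of_deliver (E := E) h₁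
    obtain ⟨b', T', i', j', hb', hj', h₂'⟩ := exists_bcast_of_deliver (E := E) h₂
    obtain rfl := hu _ _ _ _ ha ha'.1
    obtain rfl := hu _ _ _ _ hb hb'.1
    have h₃ := ha'.performs hj
    rw [he.2, hp] at h₁' h₃
    rw [hf.2] at h₂'
    have h₄ := hb'.performs hj'
    rw [hf.2] at h₄
    exact hb_of_fifo h₁' h₂' h₃ h₄ hp (by rw [ev, ev, ht]) (ha'.idx_ev_lt hj hp ht hlt)

/-- The chain runs from the receipt of `u₁` through the end of the first critical section, the start
of the second and the send of `u₂` to its receipt. `D₁` and `D₂` may lie in any processes. -/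
theorem hb_deliver_of_hb {b₁ b₂ D₁ D₂ : Event (Fin n) SThr} {u₁ u₂ : Upd} {l : L} {r₁ w₁ r₂ w₂ : ℕ}
    {T₁ T₂ : List (TOp n Var Val Upd L)} (hu : UniqueUpdates C)
    (h₁ : E.At b₁ (.ext (.bcast u₁ (some l))) T₁) (hc₁ : SpecBlock.Critical l T₁ r₁ w₁)
    (h₂ : E.At b₂ (.ext (.bcast u₂ (some l))) T₂) (hc₂ : SpecBlock.Critical l T₂ r₂ w₂)
    (hb : HappensBefore C' (E.ev b₁ (w₁ + 1)) (E.ev b₂ r₂))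
    (hD₁ : C.Performs D₁ (.ext (.deliver u₁ (some l))))
    (hD₂ : C.Performs D₂ (.ext (.deliver u₂ (some l)))) :
    HappensBefore C' (E.ev D₁ 0) (E.ev D₂ 0) := by
  obtain ⟨a, T, i, j, ha, hj, h₁'⟩ := exists_bcast_of_deliver (E := E) hD₁
  obtain ⟨b, T', i', j', hb', hj', h₂'⟩ := exists_bcast_of_deliver (E := E) hD₂
  obtain rfl := hu _ _ _ _ ha.1 h₁.1
  obtain rfl := hu _ _ _ _ hb'.1 h₂.1
  obtain ⟨-, rfl⟩ := ha.inj h₁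
  obtain ⟨-, rfl⟩ := hb'.inj h₂
  obtain ⟨_, hr⟩ := hc₂.read_door
  exact ((hb_of_recv h₁ hc₁ hj h₁').trans hb).trans
    ((h₂.hb_of_lt hr hj' (hc₂.of_send _ _ _ _ hj')).trans (hb_of_message (h₂.performs hj') h₂'))

/-- The order of the two critical sections does not depend on the observer; the deliveries at `p`
reveal it, and it then dictates the deliveries at `q`. -/
theorem deliversBefore_of_deliversBefore (hu : UniqueUpdates C) {p : Fin n} (q : Fin n) {l : L}
    {u₁ u₂ : Upd} (h : DeliversBefore C p (E.specLt p) l u₁ u₂) :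
    DeliversBefore C q (E.specLt q) l u₁ u₂ := by
  obtain ⟨e, he, f, hf, h₁, h₂, hlt⟩ := h
  obtain ⟨b₁, T₁, -, -, hb₁, -⟩ := exists_bcast_of_deliver (E := E) h₁
  obtain ⟨b₂, T₂, -, -, hb₂, -⟩ := exists_bcast_of_deliver (E := E) h₂
  obtain ⟨r₁, w₁, hc₁⟩ := hb₁.2.2.exists_critical
  obtain ⟨r₂, w₂, hc₂⟩ := hb₂.2.2.exists_critical
  have hne : b₁ ≠ b₂ := by
    rintro rfl
    obtain rfl : u₁ = u₂ := by simpa using hb₁.1.inj hb₂.1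
    obtain rfl := deliver_unique hu h₁ h₂ (he.2.trans hf.2.symm) E
    exact (strictTotalOn_specLt p).1 e he hlt
  rcases hb_or_hb_of_bcasts hb₁ hc₁ hb₂ hc₂ hne with hb | hb
  · obtain ⟨D₁, hD₁, g₁⟩ := exists_deliver_of_bcast q hb₁
    obtain ⟨D₂, hD₂, g₂⟩ := exists_deliver_of_bcast q hb₂
    exact ⟨D₁, hD₁, D₂, hD₂, g₁, g₂,
      E.lt_of_hb (hb_deliver_of_hb hu hb₁ hc₁ hb₂ hc₂ hb g₁ g₂) hD₁.2 hD₂.2⟩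
  · exact absurd (E.lt_of_hb (hb_deliver_of_hb hu hb₂ hc₂ hb₁ hc₁ hb h₂ h₁) hf.2 he.2)
      (E.lt_asymm (ev_zero_mem_opsOf he) (ev_zero_mem_opsOf hf) hlt)

theorem pob (E : Execution init need C' C) (hu : UniqueUpdates C) : POB init C := by
  refine ⟨E.specLt, fun p => ⟨strictTotalOn_specLt p, validVars_specLt p, validBcasts_specLt hu p⟩,
    extends_specLt hu, fun p q l u₁ u₂ => ⟨deliversBefore_of_deliversBefore hu q,
    deliversBefore_of_deliversBefore hu p⟩, fun p u l => ⟨?_, ?_⟩⟩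
  · rintro ⟨b, hb⟩
    obtain ⟨T, hT⟩ := exists_at (E := E) hb
    exact exists_deliver_of_bcast p hT
  · rintro ⟨D, -, hD⟩
    obtain ⟨b, T, -, -, hb, -⟩ := exists_bcast_of_deliver (E := E) hD
    exact ⟨b, hb.1⟩

end Execution

/-! ### Existence of interpretations and assembly of the data of an execution. -/

section Correctness

variable {n : ℕ} {Var Val Upd L : Type*} {T : Fin n → SThr → Thread Var Val Upd L}
  {init : Fin n → Var → Val} {need : Fin n → L → Bool}
  {C' : Computation (Fin n) (TThr L) (TOp n Var Val Upd L)}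
  {C : Computation (Fin n) SThr (SOp Var Val Upd L)}

theorem exists_interprets (h : C' ∈ (tknProgram T).computations) : ∃ C, Interprets C' C := by
  have h' : ∀ p t, ∃ h, Implements p h (C' p (.spec t)) := fun p t =>
    (h p (.spec t)).imp fun _ h => h.2
  choose C hC using h'
  exact ⟨C, hC⟩

theorem Interprets.mem_computations (h : C' ∈ (tknProgram T).computations)
    (hC : Interprets C' C) : C ∈ (specProgram T).computations := by
  intro p t
  obtain ⟨c, hc, hc'⟩ := h p (.spec t)
  rw [implements_inj (hC p t) hc']
  exact hc

/-- The division of labour between the two threads enters the argument only here, through the fields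
`thread_bcast` and `thread_deliver`. -/
theorem exists_execution
    (hm : ∀ p h, (T p .m).IsRun h → ∀ u l, .ext (.deliver u l) ∉ h)
    (hd : ∀ p h, (T p .d).IsRun h → ∀ u l, .ext (.bcast u l) ∉ h)
    (h : C' ∈ (tknProgram T).computations) (hNW : NW (tknInit init need) C')
    (hC : Interprets C' C) : Nonempty (Execution init need C' C) := by
  have hrun := hC.mem_computations h
  have hblocks : ∀ p t, ∃ B, List.Forall₂ (SpecBlock p) (C p t) B ∧ C' p (.spec t) = B.flatten :=
    fun p t => exists_blocks_of_implements (hC p t)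
  have hrounds : ∀ p l, ∃ s R, StartBlock p l s ∧ (∀ r ∈ R, RoundBlock p l r) ∧
      C' p (.token l) <+: (s :: R).flatten := by
    intro p l
    obtain ⟨k, full, hfull, hpre⟩ := h p (.token l)
    obtain ⟨s, R, hs, hR, rfl⟩ := mem_tokenThread hfull
    exact ⟨s, R, hs, hR, hpre⟩
  choose B hB hB' using hblocks
  choose s R hs hR hpre using hrounds
  obtain ⟨-, lt, h₁, h₂, h₃⟩ := hNW
  refine ⟨⟨B, hB, hB', s, hs, R, hR, hpre, ?_, ?_, lt, fun p => (h₁ p).1, fun p => (h₁ p).2.1,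
    fun p => (h₁ p).2.2, h₂, h₃⟩⟩
  · rintro ⟨p, _ | _, k⟩ u l hb
    · rfl
    · exact absurd (List.mem_of_getElem? hb) (hd p _ (hrun p .d) u l)
  · rintro ⟨p, _ | _, k⟩ u l hb
    · exact absurd (List.mem_of_getElem? hb) (hm p _ (hrun p .m) u l)
    · rfl

end Correctness

end TokenRing

theorem mainTheorem2 {n : ℕ} {Var Val Upd L : Type*}
    (T : Fin n → TokenRing.SThr → TokenRing.Thread Var Val Upd L)
    (init : Fin n → Var → Val) (need : Fin n → L → Bool)
    (hm : ∀ p h, (T p .m).IsRun h → ∀ u l, .ext (.deliver u l) ∉ h)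
    (hd : ∀ p h, (T p .d).IsRun h → ∀ u l, .ext (.bcast u l) ∉ h) :
    TokenRing.CorrectlyImplements (TokenRing.specProgram T) (TokenRing.tknProgram T)
      TokenRing.Interprets TokenRing.UniqueUpdates (TokenRing.POB init)
      (TokenRing.NW (TokenRing.tknInit init need)) := by
  rintro C' ⟨hC', hNW⟩
  refine ⟨TokenRing.exists_interprets hC', fun C hC => ?_⟩
  have hrun := hC.mem_computations hC'
  obtain ⟨E⟩ := TokenRing.exists_execution hm hd hC' hNW hC
  exact ⟨hrun, fun hu => ⟨hrun, E.pob hu⟩⟩
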